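/- All Banach algebras are complex and need not have an identity. Let $\Omega$ be a locally compact Hausdorff space and let $\mathcal U=\{\Omega,(A_t)_{t\in\Omega},\Theta\}$ be a continuous field of Banach algebras, that is, $\Theta$ is a subalgebra of $\prod_{t\in\Omega}A_t$ such that (a) $\{x(t):x\in\Theta\}$ is dense in $A_t$ for every $t$; (b) $t\mapsto\|x(t)\|$ is continuous for every $x\in\Theta$; (c) $x\in\prod_t A_t$ belongs to $\Theta$ whenever for all $t\in\Omega$ and $\varepsilon>0$ there is $x'\in\Theta$ with $\|x(s)-x'(s)\|\le\varepsilon$ for all $s$ in some neighbourhood of $t$. For $Y\subseteq\Omega$, the field $\mathcal U|_Y$ over $Y$ has fibres $(A_t)_{t\in Y}$, and its continuous vector fields are those $x\in\prod_{t\in Y}A_t$ such that for all $t_0\in Y$ and $\varepsilon>0$ there is $x'\in\Theta$ with $\|x(t)-x'(t)\|\le\varepsilon$ for all $t$ in some neighbourhood of $t_0$ in $Y$. A field over $Y$ is trivial if there are a Banach algebra $B$ and isometric algebra isomorphisms of its fibres onto $B$ that carry its continuous vector fields onto the continuous maps $Y\to B$. Suppose that $\mathcal U$ is locally trivial (every point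 of $\Omega$ has an open neighbourhood $V$ with $\mathcal U|_V$ trivial), that every $A_t$ is non-zero and has an identity $e_{A_t}$, and that $\sup_{t\in\Omega}\|e_{A_t}\|\le C$ for some constant $C$. Let $\mathfrak A$ be the Banach algebra of all $x\in\Theta$ such that $\|x(t)\|$ vanishes at infinity on $\Omega$, with the norm $\|x\|=\sup_{t}\|x(t)\|$. Then the following conditions are equivalent: (i) $\Omega$ is paracompact; (ii) $\mathfrak A$ is left projective: for each left Banach $\mathfrak A$-module $Y$, every bounded left $\mathfrak A$-module morphism $\varphi:Y\to\mathfrak A$ that has a bounded linear right inverse has a right inverse that is a bounded left $\mathfrak A$-module morphism; (iii) $\mathfrak A$ is left projective and $\mathcal U$ is a disjoint union of $\sigma$-locally trivial fields: $\Omega$ is a disjoint union of open sets $W_\mu$ such that for each $\mu$ there are an open cover $\{U_\alpha\}$ of $W_\mu$ with every $\mathcal U|_{U_\alpha}$ trivial, and a countable open cover $\{V_j\}$ of $W_\mu$ such that for each $j$ the closure of $V_j$ in $W_\mu$ is contained in some $U_\alpha$; (iv) $\mathcal H^2(\mathfrak A,X)=\{0\}$ for every Banach $\mathfrak A$-bimodule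 $X$ with $X\cdot\mathfrak A=\{0\}$, where $\mathcal H^2(\mathfrak A,X)$ is the second continuous Hochschild cohomology group of $\mathfrak A$ with coefficients in $X$. -/

import Mathlib

open scoped ENNReal
open Filter Topology Set

universe u v w

/-!  Throughout, Banach algebras are complex, associative and not assumed to be unital: a Banach algebra
is a type `A` with `[NonUnitalNormedRing A] [NormedSpace ℂ A] [IsScalarTower ℂ A A]
[SMulCommClass ℂ A A] [CompleteSpace A]`. -/

section Fields

/-- A continuous field of Banach algebras over `Ω` with fibres `A t`: a subalgebra `Θ` of `∏ t, A t`
(the continuous vector fields) with the usual three axioms. -/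
structure ContinuousField (Ω : Type u) [TopologicalSpace Ω] (A : Ω → Type v)
    [∀ t, NonUnitalNormedRing (A t)] [∀ t, NormedSpace ℂ (A t)] where
  /-- The algebra of continuous vector fields. -/
  Θ : NonUnitalSubalgebra ℂ (∀ t, A t)
  dense_eval : ∀ t, Dense {a : A t | ∃ x ∈ Θ, x t = a}
  continuous_norm : ∀ x ∈ Θ, Continuous fun t => ‖x t‖
  mem_of_locally_approx : ∀ x : ∀ t, A t,
    (∀ t, ∀ ε > 0, ∃ x' ∈ Θ, ∀ᶠ s in 𝓝 t, ‖x s - x' s‖ ≤ ε) → x ∈ Θ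

/-- An isomorphism between two continuous fields over `Ω`: a family of isometric isomorphisms of
Banach algebras between the fibres that carries `Θ` onto `Θ'`. -/
structure ContinuousField.Iso {Ω : Type u} [TopologicalSpace Ω] {A A' : Ω → Type v}
    [∀ t, NonUnitalNormedRing (A t)] [∀ t, NormedSpace ℂ (A t)]
    [∀ t, NonUnitalNormedRing (A' t)] [∀ t, NormedSpace ℂ (A' t)]
    (U : ContinuousField Ω A) (U' : ContinuousField Ω A') where
  /-- The fibrewise isometric isomorphisms. -/
  toFun : ∀ t, A t ≃ₗᵢ[ℂ] A' t
  map_mul : ∀ t (a b : A t), toFun t (a * b) = toFun t a * toFun t b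
  mem_iff : ∀ x : ∀ t, A t, x ∈ U.Θ ↔ (fun t => toFun t (x t)) ∈ U'.Θ

/-- The constant field over `Ω` defined by the Banach algebra `B`. -/
def ContinuousField.const (Ω : Type u) [TopologicalSpace Ω] (B : Type v) [NonUnitalNormedRing B]
    [NormedSpace ℂ B] : ContinuousField Ω (fun _ => B) where
  Θ :=
    { carrier := {x | Continuous x}
      add_mem' := fun {_ _} hx hy => Continuous.add hx hy
      zero_mem' := continuous_const
      mul_mem' := fun {_ _} hx hy => Continuous.mul hx hy
      smul_mem' := fun c _ hx => Continuous.const_smul hx c }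
  dense_eval := fun t => by
    have h : {a : B | ∃ x ∈ ({ carrier := {x : Ω → B | Continuous x}
                               add_mem' := fun {_ _} hx hy => Continuous.add hx hy
                               zero_mem' := continuous_const
                               mul_mem' := fun {_ _} hx hy => Continuous.mul hx hy
                               smul_mem' := fun c _ hx => Continuous.const_smul hx c } :
                              NonUnitalSubalgebra ℂ (Ω → B)), x t = a} = univ := by
      ext a
      refine ⟨fun _ => mem_univ _, fun _ => ?_⟩
      exact ⟨fun _ => a, continuous_const, rfl⟩
    rw [h]
    exact dense_univ
  continuous_norm := fun _ hx => Continuous.norm hx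
  mem_of_locally_approx := fun x hx => by
    change Continuous x
    rw [continuous_iff_continuousAt]
    intro t
    rw [Metric.continuousAt_iff']
    intro ε hε
    obtain ⟨x', hx', h⟩ := hx t (ε / 4) (by positivity)
    have hc : Continuous x' := hx'
    have h2 := Metric.continuousAt_iff'.1 (hc.continuousAt (x := t)) (ε / 4) (by positivity)
    have h3 := h.self_of_nhds
    filter_upwards [h, h2] with s hs hs2
    rw [dist_eq_norm] at hs2 ⊢
    have e : x s - x t = (x s - x' s) + (x' s - x' t) - (x t - x' t) := by abel
    rw [e]
    calc _ ≤ ‖(x s - x' s) + (x' s - x' t)‖ + ‖x t - x' t‖ := norm_sub_le _ _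
      _ ≤ ‖x s - x' s‖ + ‖x' s - x' t‖ + ‖x t - x' t‖ := by gcongr; exact norm_add_le _ _
      _ < ε := by linarith

variable {Ω : Type u} [TopologicalSpace Ω] {A : Ω → Type v}
  [∀ t, NonUnitalNormedRing (A t)] [∀ t, NormedSpace ℂ (A t)]

namespace ContinuousField

/-- Continuity of a vector field `x` over `Y ⊆ Ω` at the point `t₀ ∈ Y`; neighbourhoods are taken
in the subspace `Y`. -/
def ContinuousOnAt (U : ContinuousField Ω A) {Y : Set Ω} (x : ∀ t : Y, A t) (t₀ : Y) : Prop :=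
  ∀ ε > 0, ∃ x' ∈ U.Θ, ∀ᶠ t : Y in 𝓝 t₀, ‖x t - x' t‖ ≤ ε

theorem continuousOnAt_norm (U : ContinuousField Ω A) {Y : Set Ω} {x : ∀ t : Y, A t} {t₀ : Y}
    (hx : U.ContinuousOnAt x t₀) : ContinuousAt (fun t : Y => ‖x t‖) t₀ := by
  rw [Metric.continuousAt_iff']
  intro ε hε
  obtain ⟨x', hx', h⟩ := hx (ε / 4) (by positivity)
  have hc : Continuous fun t : Y => ‖x' t‖ := (U.continuous_norm x' hx').comp continuous_subtype_val
  have h2 := Metric.continuousAt_iff'.1 (hc.continuousAt (x := t₀)) (ε / 4) (by positivity)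
  have h3 := h.self_of_nhds
  filter_upwards [h, h2] with s hs hs2
  rw [Real.dist_eq, abs_lt] at hs2 ⊢
  have a1 := abs_le.1 ((abs_norm_sub_norm_le (x s) (x' s)).trans hs)
  have a2 := abs_le.1 ((abs_norm_sub_norm_le (x t₀) (x' t₀)).trans h3)
  constructor <;> linarith [a1.1, a1.2, a2.1, a2.2, hs2.1, hs2.2]

theorem continuousOnAt_mul (U : ContinuousField Ω A) {Y : Set Ω} {x y : ∀ t : Y, A t} {t₀ : Y}
    (hx : U.ContinuousOnAt x t₀) (hy : U.ContinuousOnAt y t₀) :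
    U.ContinuousOnAt (fun t => x t * y t) t₀ := by
  intro ε hε
  set M : ℝ := ‖x t₀‖ + 1 with hM
  have hM0 : 0 < M := by positivity
  obtain ⟨y', hy', h1⟩ := hy (ε / (2 * M)) (by positivity)
  set N : ℝ := ‖y' t₀‖ + 1 with hN
  have hN0 : 0 < N := by positivity
  obtain ⟨x', hx', h2⟩ := hx (ε / (2 * N)) (by positivity)
  have hxn : ∀ᶠ t : Y in 𝓝 t₀, ‖x t‖ < M :=
    (U.continuousOnAt_norm hx).eventually_lt_const (by simp [hM])
  have hc : Continuous fun t : Y => ‖y' t‖ := (U.continuous_norm y' hy').comp continuous_subtype_val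
  have hyn : ∀ᶠ t : Y in 𝓝 t₀, ‖y' t‖ < N :=
    hc.continuousAt.eventually_lt_const (by simp [hN])
  refine ⟨x' * y', U.Θ.mul_mem hx' hy', ?_⟩
  filter_upwards [h1, h2, hxn, hyn] with t a1 a2 a3 a4
  have e : x t * y t - (x' * y') t = x t * (y t - y' t) + (x t - x' t) * y' t := by
    simp only [Pi.mul_apply, mul_sub, sub_mul]; abel
  rw [e]
  calc _ ≤ ‖x t * (y t - y' t)‖ + ‖(x t - x' t) * y' t‖ := norm_add_le _ _
    _ ≤ ‖x t‖ * ‖y t - y' t‖ + ‖x t - x' t‖ * ‖y' t‖ := by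
        gcongr <;> exact norm_mul_le _ _
    _ ≤ M * (ε / (2 * M)) + ε / (2 * N) * N := by gcongr
    _ = ε := by field_simp; ring

/-- The field `U|_Y` induced by `U` on `Y ⊆ Ω`: its continuous vector fields are the vector fields
over `Y` that are continuous at every point of `Y`. -/
def restrict (U : ContinuousField Ω A) (Y : Set Ω) : ContinuousField Y (fun t => A t) where
  Θ :=
    { carrier := {x | ∀ t₀ : Y, U.ContinuousOnAt x t₀}
      add_mem' := fun {x y} hx hy t₀ ε hε => by
        obtain ⟨x', hx', h1⟩ := hx t₀ (ε / 2) (by positivity)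
        obtain ⟨y', hy', h2⟩ := hy t₀ (ε / 2) (by positivity)
        refine ⟨x' + y', U.Θ.add_mem hx' hy', ?_⟩
        filter_upwards [h1, h2] with t a1 a2
        have e : (x + y) t - (x' + y') t = (x t - x' t) + (y t - y' t) := by
          simp only [Pi.add_apply]; abel
        rw [e]
        exact (norm_add_le _ _).trans (by linarith)
      zero_mem' := fun t₀ ε hε => ⟨0, U.Θ.zero_mem, by simp [hε.le]⟩
      mul_mem' := fun {x y} hx hy t₀ => U.continuousOnAt_mul (hx t₀) (hy t₀)
      smul_mem' := fun c x hx t₀ ε hε => by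
        obtain ⟨x', hx', h1⟩ := hx t₀ (ε / (‖c‖ + 1)) (by positivity)
        refine ⟨c • x', SMulMemClass.smul_mem c hx', ?_⟩
        filter_upwards [h1] with t a1
        have e : (c • x) t - (c • x') t = c • (x t - x' t) := by
          simp only [Pi.smul_apply, smul_sub]
        rw [e, norm_smul]
        calc _ ≤ (‖c‖ + 1) * (ε / (‖c‖ + 1)) := by gcongr; linarith
          _ = ε := by field_simp }
  dense_eval := fun t => (U.dense_eval t).mono (by
    rintro a ⟨x, hx, rfl⟩
    refine ⟨fun s => x s, ?_, rfl⟩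
    exact fun t₀ ε hε => ⟨x, hx, Eventually.of_forall fun s => by simp [hε.le]⟩)
  continuous_norm := fun x hx => continuous_iff_continuousAt.2 fun t => U.continuousOnAt_norm (hx t)
  mem_of_locally_approx := fun x hx t₀ ε hε => by
    obtain ⟨y, hy, h1⟩ := hx t₀ (ε / 2) (by positivity)
    obtain ⟨x', hx', h2⟩ := hy t₀ (ε / 2) (by positivity)
    refine ⟨x', hx', ?_⟩
    filter_upwards [h1, h2] with t a1 a2
    have e : x t - x' t = (x t - y t) + (y t - x' t) := by abel
    rw [e]
    exact (norm_add_le _ _).trans (by linarith)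

/-- `U` is trivial: it is isomorphic to the constant field defined by some Banach algebra. (The
fibres and `B` live in the same universe; over a non-empty base this is no restriction, as `B` is
isomorphic to each fibre.) -/
def IsTrivial (U : ContinuousField Ω A) : Prop :=
  ∃ (B : Type v) (_ : NonUnitalNormedRing B) (_ : NormedSpace ℂ B) (_ : IsScalarTower ℂ B B)
    (_ : SMulCommClass ℂ B B) (_ : CompleteSpace B), Nonempty (U.Iso (const Ω B))

/-- Every point has an open neighbourhood on which the field is trivial. -/
def IsLocallyTrivial (U : ContinuousField Ω A) : Prop :=
  ∀ t : Ω, ∃ V : Set Ω, IsOpen V ∧ t ∈ V ∧ (U.restrict V).IsTrivial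

/-- `U` is σ-locally trivial: there are an open cover `𝒰` of `Ω` by sets on which `U` is trivial and
a countable open cover `𝒱` of `Ω` such that the closure of each member of `𝒱` lies in a member
of `𝒰`. -/
def IsSigmaLocallyTrivial (U : ContinuousField Ω A) : Prop :=
  ∃ 𝒰 : Set (Set Ω), (∀ O ∈ 𝒰, IsOpen O ∧ (U.restrict O).IsTrivial) ∧ ⋃₀ 𝒰 = univ ∧
    ∃ 𝒱 : Set (Set Ω), 𝒱.Countable ∧ (∀ V ∈ 𝒱, IsOpen V ∧ ∃ O ∈ 𝒰, closure V ⊆ O) ∧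
      ⋃₀ 𝒱 = univ

/-- `U` is a disjoint union of σ-locally trivial fields: `Ω` is the union of a family of pairwise
disjoint open sets `W` such that each `U|_W` is σ-locally trivial. -/
def IsDisjointUnionOfSigmaLocallyTrivial (U : ContinuousField Ω A) : Prop :=
  ∃ 𝒲 : Set (Set Ω), (∀ W ∈ 𝒲, IsOpen W) ∧ 𝒲.PairwiseDisjoint id ∧ ⋃₀ 𝒲 = univ ∧
    ∀ W ∈ 𝒲, (U.restrict W).IsSigmaLocallyTrivial

/-- A continuous vector field vanishing at infinity is bounded. -/
theorem memℓp_of_tendsto (U : ContinuousField Ω A) {x : ∀ t, A t} (hx : x ∈ U.Θ)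
    (h0 : Tendsto (fun t => ‖x t‖) (cocompact Ω) (𝓝 0)) : Memℓp x ∞ := by
  rw [memℓp_infty_iff]
  have h1 : ∀ᶠ t in cocompact Ω, ‖x t‖ < 1 := h0.eventually_lt_const one_pos
  obtain ⟨K, hK, hKs⟩ := mem_cocompact.1 h1
  obtain ⟨C, hC⟩ := (hK.image (U.continuous_norm x hx)).bddAbove
  refine ⟨max C 1, ?_⟩
  rintro _ ⟨t, rfl⟩
  by_cases ht : t ∈ K
  · exact (hC ⟨t, ht, rfl⟩).trans (le_max_left _ _)
  · exact (le_of_lt (hKs ht)).trans (le_max_right _ _)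

/-- The Banach algebra defined by `U`: the continuous vector fields `x ∈ Θ` whose norm vanishes at
infinity, with the norm `sup_t ‖x t‖`. It is realised inside the Banach algebra `lp A ∞` of all
bounded vector fields with the supremum norm; this is no restriction by `memℓp_of_tendsto`. -/
def sectionAlgebra (U : ContinuousField Ω A) : NonUnitalSubalgebra ℂ (lp A ∞) where
  carrier := {x | (x : ∀ t, A t) ∈ U.Θ ∧ Tendsto (fun t => ‖x t‖) (cocompact Ω) (𝓝 0)}
  add_mem' := fun {x y} hx hy => ⟨U.Θ.add_mem hx.1 hy.1, by
    refine squeeze_zero (fun _ => norm_nonneg _) (fun t => norm_add_le (x t) (y t)) ?_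
    simpa using hx.2.add hy.2⟩
  zero_mem' := ⟨U.Θ.zero_mem, by simpa using tendsto_const_nhds⟩
  mul_mem' := fun {x y} hx hy => ⟨U.Θ.mul_mem hx.1 hy.1, by
    refine squeeze_zero (fun _ => norm_nonneg _) (fun t => norm_mul_le (x t) (y t)) ?_
    simpa using hx.2.mul hy.2⟩
  smul_mem' := fun c x hx => ⟨SMulMemClass.smul_mem c hx.1, by
    have : Tendsto (fun t => ‖c‖ * ‖x t‖) (cocompact Ω) (𝓝 0) := by simpa using hx.2.const_mul ‖c‖
    simpa [norm_smul] using this⟩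

theorem sectionAlgebra_norm_def (U : ContinuousField Ω A) (x : U.sectionAlgebra) :
    ‖x‖ = ⨆ t, ‖(x : lp A ∞) t‖ :=
  lp.norm_eq_ciSup (x : lp A ∞)

noncomputable instance (U : ContinuousField Ω A) : NormedSpace ℂ U.sectionAlgebra where
  norm_smul_le c x := norm_smul_le c (x : lp A ∞)

instance [∀ t, IsScalarTower ℂ (A t) (A t)] (U : ContinuousField Ω A) :
    IsScalarTower ℂ U.sectionAlgebra U.sectionAlgebra where
  smul_assoc c x y := Subtype.ext (smul_assoc c (x : lp A ∞) (y : lp A ∞))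

instance [∀ t, SMulCommClass ℂ (A t) (A t)] (U : ContinuousField Ω A) :
    SMulCommClass ℂ U.sectionAlgebra U.sectionAlgebra where
  smul_comm c x y := Subtype.ext (smul_comm c (x : lp A ∞) (y : lp A ∞))

/-- The normed algebra defined by a continuous field of Banach algebras is complete. -/
instance [∀ t, CompleteSpace (A t)] (U : ContinuousField Ω A) : CompleteSpace U.sectionAlgebra := by
  have key : ∀ (f g : lp A ∞) (t : Ω), ‖f t - g t‖ ≤ dist f g := fun f g t => by
    rw [dist_eq_norm]
    exact lp.norm_apply_le_norm ENNReal.top_ne_zero (f - g) t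
  have hcl : IsClosed (U.sectionAlgebra : Set (lp A ∞)) := by
    refine isClosed_of_closure_subset fun f hf => ?_
    rw [Metric.mem_closure_iff] at hf
    refine ⟨U.mem_of_locally_approx _ fun t ε hε => ?_, ?_⟩
    · obtain ⟨g, hg, hd⟩ := hf ε hε
      exact ⟨g, hg.1, Eventually.of_forall fun s => (key f g s).trans hd.le⟩
    · rw [Metric.tendsto_nhds]
      intro ε hε
      obtain ⟨g, hg, hd⟩ := hf (ε / 2) (by positivity)
      filter_upwards [Metric.tendsto_nhds.1 hg.2 (ε / 2) (by positivity)] with s hs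
      simp only [dist_zero_right, norm_norm] at hs ⊢
      calc ‖f s‖ = ‖(f s - g s) + g s‖ := by rw [sub_add_cancel]
        _ ≤ ‖f s - g s‖ + ‖g s‖ := norm_add_le _ _
        _ < ε := by linarith [key f g s]
  exact hcl.completeSpace_coe

end ContinuousField

end Fields

section Modules

/-- A structure of left Banach `R`-module on the Banach space `X`: a bounded bilinear associative
multiplication `(a, x) ↦ a · x = act a x`. -/
structure LeftBanachModule (R : Type w) [NonUnitalNormedRing R] [NormedSpace ℂ R]
    (X : Type w) [NormedAddCommGroup X] [NormedSpace ℂ X] where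
  /-- The module multiplication. -/
  act : R →L[ℂ] X →L[ℂ] X
  mul_act : ∀ a b x, act (a * b) x = act a (act b x)

/-- A Banach `R`-bimodule structure on the Banach space `X`, with `left a x = a · x` and
`right a x = x · a`. -/
structure BanachBimodule (R : Type w) [NonUnitalNormedRing R] [NormedSpace ℂ R]
    (X : Type w) [NormedAddCommGroup X] [NormedSpace ℂ X] where
  /-- Left multiplication `a · x`. -/
  left : R →L[ℂ] X →L[ℂ] X
  /-- Right multiplication `x · a`. -/
  right : R →L[ℂ] X →L[ℂ] X
  mul_left : ∀ a b x, left (a * b) x = left a (left b x)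
  mul_right : ∀ a b x, right (a * b) x = right b (right a x)
  left_right : ∀ a b x, right b (left a x) = left a (right b x)

variable (R : Type w) [NonUnitalNormedRing R] [NormedSpace ℂ R]
  [IsScalarTower ℂ R R] [SMulCommClass ℂ R R]

/-- `R` as a left Banach module over itself. -/
noncomputable def LeftBanachModule.regular : LeftBanachModule R R where
  act := ContinuousLinearMap.mul ℂ R
  mul_act := fun a b x => by simp [mul_assoc]

variable {R}

/-- The left Banach module `P` is projective: every morphism of left Banach modules `φ : Y → P`
which has a right inverse as a morphism of Banach spaces (in particular, `φ` is onto) has a right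
inverse which is a morphism of left Banach modules. -/
def LeftBanachModule.IsProjective {P : Type w} [NormedAddCommGroup P] [NormedSpace ℂ P]
    (mP : LeftBanachModule R P) : Prop :=
  ∀ (Y : Type w) [NormedAddCommGroup Y] [NormedSpace ℂ Y] [CompleteSpace Y]
    (mY : LeftBanachModule R Y) (φ : Y →L[ℂ] P),
    (∀ a y, φ (mY.act a y) = mP.act a (φ y)) →
    (∃ σ : P →L[ℂ] Y, ∀ p, φ (σ p) = p) →
    ∃ ψ : P →L[ℂ] Y, (∀ a p, ψ (mP.act a p) = mY.act a (ψ p)) ∧ ∀ p, φ (ψ p) = p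

/-- A Banach algebra is left projective if it is projective as a left Banach module over itself. -/
def IsLeftProjective (R : Type w) [NonUnitalNormedRing R] [NormedSpace ℂ R]
    [IsScalarTower ℂ R R] [SMulCommClass ℂ R R] : Prop :=
  (LeftBanachModule.regular R).IsProjective

namespace BanachBimodule

variable {X : Type w} [NormedAddCommGroup X] [NormedSpace ℂ X]

/-- `X · R = {0}`. -/
def IsRightAnnihilator (m : BanachBimodule R X) : Prop := ∀ a x, m.right a x = 0

open ContinuousLinearMap in
/-- The coboundary `δ¹` from bounded linear operators `R → X` to bounded bilinear operators
`R × R → X`, see `δ₁_apply`. -/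
noncomputable def δ₁ (m : BanachBimodule R X) : (R →L[ℂ] X) →ₗ[ℂ] (R →L[ℂ] R →L[ℂ] X) where
  toFun f := ((compL ℂ R X X).flip f).comp m.left - (compL ℂ R R X f).comp (mul ℂ R)
    + m.right.flip.comp f
  map_add' f g := by ext a b; simp; abel
  map_smul' c f := by ext a b; simp [smul_sub]

theorem δ₁_apply (m : BanachBimodule R X) (f : R →L[ℂ] X) (a b : R) :
    m.δ₁ f a b = m.left a (f b) - f (a * b) + m.right b (f a) := by
  simp [δ₁]

open ContinuousLinearMap in
/-- The coboundary `δ²` from bounded bilinear operators `R × R → X` to bounded trilinear operators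
`R × R × R → X`, see `δ₂_apply`. -/
noncomputable def δ₂ (m : BanachBimodule R X) :
    (R →L[ℂ] R →L[ℂ] X) →ₗ[ℂ] (R →L[ℂ] R →L[ℂ] R →L[ℂ] X) where
  toFun g := ((compL ℂ R (R →L[ℂ] X) (R →L[ℂ] X)).flip g).comp ((compL ℂ R X X).comp m.left)
    - (compL ℂ R R (R →L[ℂ] X) g).comp (mul ℂ R)
    + (((compL ℂ R (R →L[ℂ] R) (R →L[ℂ] X)).flip (mul ℂ R)).comp (compL ℂ R R X)).comp g
    - (compL ℂ R X (R →L[ℂ] X) m.right.flip).comp g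
  map_add' f g := by ext a b c; simp; abel
  map_smul' c f := by ext a b d; simp [smul_sub]

theorem δ₂_apply (m : BanachBimodule R X) (g : R →L[ℂ] R →L[ℂ] X) (a b c : R) :
    m.δ₂ g a b c = m.left a (g b c) - g (a * b) c + g a (b * c) - m.right c (g a b) := by
  simp [δ₂]

/-- The bounded 2-cocycles. -/
noncomputable def Z2 (m : BanachBimodule R X) : Submodule ℂ (R →L[ℂ] R →L[ℂ] X) :=
  LinearMap.ker m.δ₂

/-- The bounded 2-coboundaries. -/
noncomputable def B2 (m : BanachBimodule R X) : Submodule ℂ (R →L[ℂ] R →L[ℂ] X) :=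
  LinearMap.range m.δ₁

/-- `δ² ∘ δ¹ = 0`. -/
theorem B2_le_Z2 (m : BanachBimodule R X) : m.B2 ≤ m.Z2 := by
  rintro _ ⟨f, rfl⟩
  change m.δ₂ (m.δ₁ f) = 0
  ext a b c
  simp only [δ₂_apply, δ₁_apply, map_add, map_sub, m.mul_left, m.mul_right, m.left_right, mul_assoc,
    zero_apply]
  abel

/-- The second continuous Hochschild cohomology group `H²(R, X) = ker δ² / im δ¹`, as an additive
group. -/
abbrev H2 (m : BanachBimodule R X) : Type w :=
  m.Z2.toAddSubgroup ⧸ m.B2.toAddSubgroup.addSubgroupOf m.Z2.toAddSubgroup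

theorem subsingleton_H2_iff (m : BanachBimodule R X) :
    Subsingleton m.H2 ↔ ∀ g, m.δ₂ g = 0 → ∃ f, m.δ₁ f = g := by
  constructor
  · intro h g hg
    have h1 : ((⟨g, hg⟩ : m.Z2.toAddSubgroup) : m.H2) = ((0 : m.Z2.toAddSubgroup) : m.H2) :=
      Subsingleton.elim _ _
    have h2 := (QuotientAddGroup.eq.1 h1.symm)
    rw [neg_zero, zero_add] at h2
    exact h2
  · intro h
    refine ⟨fun x y => ?_⟩
    induction x using QuotientAddGroup.induction_on with | H x => ?_
    induction y using QuotientAddGroup.induction_on with | H y => ?_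
    exact QuotientAddGroup.eq.2 (h _ (-x + y).2)

end BanachBimodule

/-- `H²(R, X) = {0}` for every right annihilator Banach `R`-bimodule `X`. -/
def H2VanishesOnRightAnnihilators (R : Type w) [NonUnitalNormedRing R] [NormedSpace ℂ R]
    [IsScalarTower ℂ R R] [SMulCommClass ℂ R R] : Prop :=
  ∀ (X : Type w) [NormedAddCommGroup X] [NormedSpace ℂ X] [CompleteSpace X]
    (m : BanachBimodule R X), m.IsRightAnnihilator → Subsingleton m.H2

end Modules

/-!
Paracompactness of a locally compact Hausdorff space amounts to the existence of a neighbourhood of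
the diagonal in `Ω × Ω` whose points over a compact set are relatively compact, and also to a
splitting into open σ-compact pieces.

If `Ω` is paracompact, there are compactly supported `k i ≥ 0`, locally finite, with `∑ k i ^ 2 = 1`
and `∑ k i ≤ 2`. The elements `E i = k i • e` of `𝔄` then give a formal approximate diagonal
`∑ E i ⊗ E i`, whose partial sums are bounded in the projective tensor product because each of them
is an average of `(∑ ± E i) ⊗ (∑ ± E i)` over all choices of signs. Averaging a bounded linear right
inverse over it yields a module right inverse.

Conversely, let `F` range over the bounded families `F T ∈ A s` indexed by the isometries
`T : A t ≃ A s` of fibres; they replace the projective tensor square of `𝔄`. Restriction to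
the identities has the bounded linear right inverse `a ↦ (T ↦ T (a t))`. If it has a module right
inverse `ψ`, then `ψ (f • e)`, with `f = 1` near `s`, has norm at least `1 / 2` near the diagonal,
while it vanishes at infinity in `t` over compact sets of `s`.

A `2`-cocycle with coefficients in a right annihilator bimodule is the same thing as a linearly
split extension of the left module `𝔄`, and a coboundary corresponds to a module splitting.
-/

open scoped CompactlySupported

section Topology

theorem paracompactSpace_of_isLocallyConstant {X : Type u} {D : Type v} [TopologicalSpace X]
    {p : X → D} (hp : IsLocallyConstant p) (hfib : ∀ d, ParacompactSpace (p ⁻¹' {d})) :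
    ParacompactSpace X := by
  refine ⟨fun α u uo uc => ?_⟩
  have hrefine : ∀ d, ∃ v : α → Set (p ⁻¹' {d}), (∀ a, IsOpen (v a)) ∧ ⋃ a, v a = univ ∧
      LocallyFinite v ∧ ∀ a, v a ⊆ Subtype.val ⁻¹' u a := fun d =>
    precise_refinement _ (fun a => (uo a).preimage continuous_subtype_val)
      (by rw [← preimage_iUnion, uc, preimage_univ])
  choose v vo vc vf vu using hrefine
  have hopen : ∀ d, IsOpenMap (Subtype.val : p ⁻¹' {d} → X) := fun d =>
    (hp.isOpen_fiber d).isOpenMap_subtype_val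
  refine ⟨α, fun a => ⋃ d, Subtype.val '' v d a, fun a => isOpen_iUnion fun d => hopen d _ (vo d a),
    eq_univ_of_forall fun x => ?_, fun x => ?_,
    fun a => ⟨a, iUnion_subset fun d => image_subset_iff.2 (vu d a)⟩⟩
  · obtain ⟨a, ha⟩ := mem_iUnion.1 ((vc (p x)).symm ▸ mem_univ (⟨x, rfl⟩ : p ⁻¹' {p x}))
    exact mem_iUnion₂.2 ⟨a, p x, _, ha, rfl⟩
  · obtain ⟨t, ht, hfin⟩ := vf (p x) ⟨x, rfl⟩
    refine ⟨Subtype.val '' t, (hopen (p x)).image_mem_nhds ht, hfin.subset ?_⟩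
    rintro a ⟨_, hy, z, hz, rfl⟩
    obtain ⟨d, y, hya, hyz⟩ := mem_iUnion.1 hy
    obtain rfl : d = p x := by rw [← show p y = d from y.2, hyz]; exact z.2
    exact ⟨z, Subtype.ext hyz ▸ hya, hz⟩

variable {Ω : Type u} [TopologicalSpace Ω]

/-- A relation on `Ω`, seen as a subset `{(x, y) | R x y}` of `Ω × Ω`, is a *proper neighbourhood
of the diagonal* if it is a neighbourhood of the diagonal and the set of all points related to the
points of a compact set is relatively compact. -/
structure IsProperDiagonalNhd (R : Ω → Ω → Prop) : Prop where
  eventually_prod : ∀ x, ∀ᶠ p in 𝓝 (x, x), R p.1 p.2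
  exists_isCompact : ∀ K, IsCompact K → ∃ L, IsCompact L ∧ ∀ x ∈ K, ∀ y, R x y → y ∈ L

theorem IsProperDiagonalNhd.exists_of_paracompact [LocallyCompactSpace Ω] [ParacompactSpace Ω] :
    ∃ R : Ω → Ω → Prop, IsProperDiagonalNhd R := by
  choose K hK hxK using fun x : Ω => exists_compact_mem_nhds x
  obtain ⟨V, hVo, hVc, hVf, hVK⟩ := precise_refinement (fun x => interior (K x))
    (fun _ => isOpen_interior)
    (eq_univ_of_forall fun x => mem_iUnion.2 ⟨x, mem_interior_iff_mem_nhds.2 (hxK x)⟩)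
  refine ⟨fun x y => ∃ i, x ∈ V i ∧ y ∈ V i, fun x => ?_, fun C hC => ?_⟩
  · obtain ⟨i, hi⟩ := mem_iUnion.1 (hVc.symm ▸ mem_univ x)
    have hV := (hVo i).mem_nhds hi
    exact mem_of_superset (prod_mem_nhds hV hV) fun p hp => ⟨i, hp⟩
  · refine ⟨⋃ i ∈ {i | (V i ∩ C).Nonempty}, K i,
      (hVf.finite_nonempty_inter_compact hC).isCompact_biUnion fun i _ => hK i, ?_⟩
    rintro x hx y ⟨i, hxi, hyi⟩
    exact mem_biUnion (show (V i ∩ C).Nonempty from ⟨x, hxi, hx⟩) (interior_subset (hVK i hyi))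

/-- A partition of `Ω` into open sets together with a locally bounded rank function that exhausts
each part by relatively compact sets. The partition is encoded by the map `part` that sends a point
to (the index of) its part. -/
structure ExhaustedPartition (Ω : Type u) [TopologicalSpace Ω] where
  /-- The set of parts. -/
  Part : Type u
  /-- The part of a point. -/
  part : Ω → Part
  isLocallyConstant_part : IsLocallyConstant part
  /-- The rank function. -/
  rank : Ω → ℕ
  eventually_rank_le : ∀ x, ∀ᶠ y in 𝓝 x, rank y ≤ rank x + 1
  exists_isCompact : ∀ i n, ∃ L : Set Ω, IsCompact L ∧ ∀ x, part x = i → rank x ≤ n → x ∈ L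

theorem exists_isCompact_of_walk_length_le {G : SimpleGraph Ω}
    (hG : ∀ K, IsCompact K → ∃ L, IsCompact L ∧ ∀ x ∈ K, ∀ y, G.Adj x y → y ∈ L) (n : ℕ) :
    ∀ K : Set Ω, IsCompact K →
      ∃ L, IsCompact L ∧ ∀ x ∈ K, ∀ y (p : G.Walk x y), p.length ≤ n → y ∈ L := by
  induction n with
  | zero =>
    intro K hK
    refine ⟨K, hK, fun x hx y p hp => ?_⟩
    rwa [← SimpleGraph.Walk.eq_of_length_eq_zero (Nat.le_zero.1 hp)]
  | succ n ih =>
    intro K hK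
    obtain ⟨L, hL, hKL⟩ := hG K hK
    obtain ⟨M, hM, hLM⟩ := ih L hL
    refine ⟨K ∪ M, hK.union hM, fun x hx y p hp => ?_⟩
    cases p with
    | nil => exact Or.inl hx
    | cons h q => exact Or.inr (hLM _ (hKL x hx _ h) y q (Nat.le_of_succ_le_succ hp))

/-- The parts are the connected components of the graph given by the symmetrised relation, and the
rank is the distance to a chosen base point of the component. -/
theorem IsProperDiagonalNhd.nonempty_exhaustedPartition {R : Ω → Ω → Prop}
    (hR : IsProperDiagonalNhd R) : Nonempty (ExhaustedPartition Ω) := by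
  let G : SimpleGraph Ω :=
    { Adj x y := x ≠ y ∧ R x y ∧ R y x
      symm := ⟨fun _ _ h => ⟨h.1.symm, h.2.symm⟩⟩
      loopless := ⟨fun _ h => h.1 rfl⟩ }
  have hadj : ∀ x, ∀ᶠ y in 𝓝 x, x = y ∨ G.Adj x y := fun x => by
    filter_upwards [(Continuous.prodMk_right x).continuousAt.eventually (hR.eventually_prod x),
      (Continuous.prodMk_left x).continuousAt.eventually (hR.eventually_prod x)] with y hxy hyx
    exact (eq_or_ne x y).imp_right fun hne => ⟨hne, hxy, hyx⟩
  let base : G.ConnectedComponent → Ω := fun i => i.exists_rep.choose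
  have hbase : ∀ x, G.Reachable (base (G.connectedComponentMk x)) x := fun x =>
    SimpleGraph.ConnectedComponent.exact (G.connectedComponentMk x).exists_rep.choose_spec
  have hpart : ∀ x y, x = y ∨ G.Adj x y →
      G.connectedComponentMk y = G.connectedComponentMk x := fun x y h =>
    h.elim (fun h => h ▸ rfl) fun h => (SimpleGraph.ConnectedComponent.sound h.reachable).symm
  refine ⟨⟨G.ConnectedComponent, G.connectedComponentMk, ?_,
    fun x => G.dist (base (G.connectedComponentMk x)) x, fun x => ?_, fun i n => ?_⟩⟩
  · exact (IsLocallyConstant.iff_eventually_eq _).2 fun x => (hadj x).mono (hpart x)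
  · filter_upwards [hadj x] with y hxy
    rw [hpart x y hxy]
    rcases hxy with rfl | hxy
    · exact Nat.le_succ _
    · exact ((hbase x).dist_triangle_left y).trans_eq
        (by rw [SimpleGraph.dist_eq_one_iff_adj.2 hxy])
  · obtain ⟨L, hL, h⟩ := exists_isCompact_of_walk_length_le (G := G) (fun K hK =>
      (hR.exists_isCompact K hK).imp fun L hL => ⟨hL.1, fun x hx y hxy => hL.2 x hx y hxy.2.1⟩)
      n {base i} isCompact_singleton
    refine ⟨L, hL, fun x hx hn => ?_⟩
    subst hx
    obtain ⟨p, hp⟩ := (hbase x).exists_walk_length_eq_dist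
    exact h _ rfl x p (hp.trans_le hn)

namespace ExhaustedPartition

variable (P : ExhaustedPartition Ω)

theorem isClopen_fiber (i : P.Part) : IsClopen (P.part ⁻¹' {i}) :=
  P.isLocallyConstant_part.isClopen_fiber i

theorem sigmaCompactSpace_fiber (i : P.Part) : SigmaCompactSpace (P.part ⁻¹' {i}) := by
  choose L hL h using P.exists_isCompact i
  exact isSigmaCompact_iff_sigmaCompactSpace.1 <|
    (isSigmaCompact_iUnion_of_isCompact L hL).of_isClosed_subset (P.isClopen_fiber i).isClosed
      fun x hx => mem_iUnion.2 ⟨P.rank x, h _ x hx le_rfl⟩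

theorem exists_continuous_rank_le [T2Space Ω] [ParacompactSpace Ω] :
    ∃ g : C(Ω, ℝ), ∀ x, (P.rank x : ℝ) ≤ g x :=
  exists_continuous_forall_mem_convex_of_local_const (t := fun x => Ici (P.rank x : ℝ))
    (fun _ => convex_Ici _) fun x => ⟨P.rank x + 1, (P.eventually_rank_le x).mono fun y hy => by
      simpa using (by exact_mod_cast hy : (P.rank y : ℝ) ≤ P.rank x + 1)⟩

end ExhaustedPartition

theorem ExhaustedPartition.paracompactSpace [T2Space Ω] [LocallyCompactSpace Ω]
    (P : ExhaustedPartition Ω) : ParacompactSpace Ω :=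
  paracompactSpace_of_isLocallyConstant P.isLocallyConstant_part fun i => by
    have := P.sigmaCompactSpace_fiber i
    have := (P.isClopen_fiber i).isOpen.locallyCompactSpace
    infer_instance

end Topology

section SquarePartition

/-- The hat function of the real line of height `1` with support `[n - 1, n + 1]`. -/
noncomputable def tent (n : ℕ) (r : ℝ) : ℝ := max 0 (1 - |r - n|)

theorem continuous_tent (n : ℕ) : Continuous (tent n) := by
  unfold tent
  fun_prop

theorem abs_sub_lt_one_of_tent_ne_zero {n : ℕ} {r : ℝ} (h : tent n r ≠ 0) : |r - n| < 1 := by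
  contrapose! h
  exact max_eq_left (by linarith)

theorem hasSum_comp_tent {f : ℝ → ℝ} (hf : f 0 = 0) {r : ℝ} (hr : 0 ≤ r) :
    HasSum (fun n => f (tent n r)) (f (1 - (r - ⌊r⌋₊)) + f (r - ⌊r⌋₊)) := by
  have hle : (⌊r⌋₊ : ℝ) ≤ r := Nat.floor_le hr
  have hlt : r < ⌊r⌋₊ + 1 := Nat.lt_floor_add_one r
  have hleft : tent ⌊r⌋₊ r = 1 - (r - ⌊r⌋₊) := by
    rw [tent, abs_of_nonneg (by linarith), max_eq_right (by linarith)]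
  have hright : tent (⌊r⌋₊ + 1) r = r - ⌊r⌋₊ := by
    rw [tent, Nat.cast_add_one, abs_of_nonpos (by linarith), max_eq_right (by linarith)]
    ring
  have hzero : ∀ n ∉ ({⌊r⌋₊, ⌊r⌋₊ + 1} : Finset ℕ), f (tent n r) = 0 := fun n hn => by
    by_contra h
    have habs := abs_lt.1 (abs_sub_lt_one_of_tent_ne_zero fun h0 => h (h0 ▸ hf))
    have h1 : ⌊r⌋₊ < n + 1 := by exact_mod_cast (by linarith : (⌊r⌋₊ : ℝ) < n + 1)
    have h2 : n < ⌊r⌋₊ + 2 := by exact_mod_cast (by linarith : (n : ℝ) < ⌊r⌋₊ + 2)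
    simp only [Finset.mem_insert, Finset.mem_singleton] at hn
    omega
  have hsum := hasSum_sum_of_ne_finset_zero (L := .unconditional ℕ) hzero
  rwa [Finset.sum_pair (Nat.succ_ne_self _).symm, hleft, hright] at hsum

variable {Ω : Type u} [TopologicalSpace Ω]

/-- A locally finite family of non-negative compactly supported functions whose squares form a
partition of unity and whose finite sums are bounded by `2`. -/
structure IsSquarePartition {ι : Type*} (k : ι → C_c(Ω, ℝ)) : Prop where
  nonneg : ∀ i t, 0 ≤ k i t
  locallyFinite : LocallyFinite fun i => Function.support (k i)
  hasSum_sq : ∀ t, HasSum (fun i => k i t ^ 2) 1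
  sum_le_two : ∀ t (F : Finset ι), ∑ i ∈ F, k i t ≤ 2

namespace ExhaustedPartition

variable [R1Space Ω] (P : ExhaustedPartition Ω) {g : C(Ω, ℝ)}
  (hg : ∀ x, (P.rank x : ℝ) ≤ g x)

/-- The square root of the `n`-th tent over the continuous majorant `g` of the rank, cut off to the
part `i`, where `j = (i, n)`. -/
noncomputable def rootTent (j : P.Part × ℕ) : C_c(Ω, ℝ) where
  toFun := (P.part ⁻¹' {j.1}).indicator fun t => √(tent j.2 (g t))
  continuous_toFun := ((continuous_tent j.2).comp g.continuous).sqrt.indicator fun t ht => by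
    rw [(P.isClopen_fiber j.1).frontier_eq] at ht
    exact ht.elim
  hasCompactSupport' := by
    obtain ⟨L, hL, h⟩ := P.exists_isCompact j.1 (j.2 + 1)
    refine HasCompactSupport.intro hL fun t ht => indicator_apply_eq_zero.2 fun hpart => ?_
    by_contra hne
    have habs := abs_lt.1 <| abs_sub_lt_one_of_tent_ne_zero fun h0 =>
      hne (by rw [h0, Real.sqrt_zero])
    refine ht (h t hpart ?_)
    exact_mod_cast (by linarith [hg t] : (P.rank t : ℝ) ≤ j.2 + 1)

theorem rootTent_apply (j : P.Part × ℕ) (t : Ω) :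
    P.rootTent hg j t = (P.part ⁻¹' {j.1}).indicator (fun t => √(tent j.2 (g t))) t :=
  rfl

theorem rootTent_part (t : Ω) (n : ℕ) : P.rootTent hg (P.part t, n) t = √(tent n (g t)) := by
  simp [rootTent_apply]

theorem eq_part_of_rootTent_ne_zero {j : P.Part × ℕ} {t : Ω} (h : P.rootTent hg j t ≠ 0) :
    P.part t = j.1 := by
  contrapose! h
  simp [rootTent_apply, h]

theorem hasSum_comp_rootTent {f : ℝ → ℝ} (hf : f 0 = 0) (t : Ω) :
    HasSum (fun j => f (P.rootTent hg j t))
      (f √(1 - (g t - ⌊g t⌋₊)) + f √(g t - ⌊g t⌋₊)) := by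
  have hsum := hasSum_comp_tent (f := fun r => f √r) (by simpa using hf)
    ((Nat.cast_nonneg _).trans (hg t))
  refine ((Prod.mk_right_injective (P.part t)).hasSum_iff fun j hj => ?_).1 ?_
  · by_contra h
    refine hj ⟨j.2, Prod.ext (P.eq_part_of_rootTent_ne_zero hg fun h0 => h (h0 ▸ hf)) rfl⟩
  · simpa only [Function.comp_def, rootTent_part] using hsum

theorem locallyFinite_support_rootTent :
    LocallyFinite fun j => Function.support (P.rootTent hg j) := fun x => by
  have hpart : ∀ᶠ y in 𝓝 x, P.part y = P.part x :=
    (IsLocallyConstant.iff_eventually_eq _).1 P.isLocallyConstant_part x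
  have hlt : ∀ᶠ y in 𝓝 x, g y < g x + 1 :=
    g.continuous.continuousAt.eventually_lt_const (lt_add_one _)
  refine ⟨_, hpart.and hlt, ((finite_singleton (P.part x)).prod
    (finite_Iic ⌈g x + 2⌉₊)).subset ?_⟩
  rintro j ⟨y, hne, hy, hgy⟩
  have hj := P.eq_part_of_rootTent_ne_zero hg hne
  obtain ⟨i, n⟩ := j
  obtain rfl : P.part y = i := hj
  refine ⟨hy, Nat.cast_le (α := ℝ).1 (le_trans ?_ (Nat.le_ceil _))⟩
  rw [Function.mem_support, rootTent_part] at hne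
  have habs := abs_sub_lt_one_of_tent_ne_zero fun h0 => hne (by rw [h0, Real.sqrt_zero])
  dsimp only
  linarith [(abs_lt.1 habs).1]

theorem isSquarePartition_rootTent : IsSquarePartition (P.rootTent hg) where
  nonneg _ _ := indicator_nonneg (fun _ _ => Real.sqrt_nonneg _) _
  locallyFinite := P.locallyFinite_support_rootTent hg
  hasSum_sq t := by
    have hsum := P.hasSum_comp_rootTent hg (f := (· ^ 2)) (by simp) t
    have hle : (⌊g t⌋₊ : ℝ) ≤ g t := Nat.floor_le ((Nat.cast_nonneg _).trans (hg t))
    rwa [Real.sq_sqrt (by linarith [Nat.lt_floor_add_one (g t)]), Real.sq_sqrt (by linarith),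
      sub_add_cancel] at hsum
  sum_le_two t F := by
    have hle : (⌊g t⌋₊ : ℝ) ≤ g t := Nat.floor_le ((Nat.cast_nonneg _).trans (hg t))
    refine (sum_le_hasSum F (fun j _ => indicator_nonneg (fun _ _ => Real.sqrt_nonneg _) _)
      (P.hasSum_comp_rootTent hg (f := id) rfl t)).trans ?_
    have h1 : √(1 - (g t - ⌊g t⌋₊)) ≤ 1 := Real.sqrt_le_one.2 (by linarith)
    have h2 : √(g t - ⌊g t⌋₊) ≤ 1 := Real.sqrt_le_one.2 (by linarith [Nat.lt_floor_add_one (g t)])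
    simp only [id]
    linarith

end ExhaustedPartition

theorem exists_isSquarePartition [T2Space Ω] [LocallyCompactSpace Ω] [ParacompactSpace Ω] :
    ∃ (ι : Type u) (k : ι → C_c(Ω, ℝ)), IsSquarePartition k := by
  obtain ⟨R, hR⟩ := IsProperDiagonalNhd.exists_of_paracompact (Ω := Ω)
  obtain ⟨P⟩ := hR.nonempty_exhaustedPartition
  obtain ⟨g, hg⟩ := P.exists_continuous_rank_le
  exact ⟨_, _, P.isSquarePartition_rootTent hg⟩

end SquarePartition

section SignAveraging

variable {ι 𝕜 X Y Z : Type*} [RCLike 𝕜] [NormedAddCommGroup X] [NormedSpace 𝕜 X]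
  [NormedAddCommGroup Y] [NormedSpace 𝕜 Y] [NormedAddCommGroup Z] [NormedSpace 𝕜 Z]

/-- All the signed sums `∑ i ∈ F, ± u i` have norm at most `p`. -/
def SignBounded (F : Finset ι) (u : ι → X) (p : ℝ) : Prop :=
  ∀ s : ι → ℤˣ, ‖∑ i ∈ F, s i • u i‖ ≤ p

theorem SignBounded.nonneg {F : Finset ι} {u : ι → X} {p : ℝ} (h : SignBounded F u p) : 0 ≤ p :=
  (norm_nonneg _).trans (h 1)

theorem SignBounded.map {F : Finset ι} {u : ι → X} {p : ℝ} (h : SignBounded F u p)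
    (f : X →L[𝕜] Y) : SignBounded F (fun i => f (u i)) (‖f‖ * p) := fun s => by
  have hf : ∑ i ∈ F, s i • f (u i) = f (∑ i ∈ F, s i • u i) := by
    simp only [map_sum, Units.smul_def, map_zsmul]
  rw [hf]
  exact f.le_opNorm_of_le (h s)

theorem sum_insert_update_smul [DecidableEq ι] {G E : Type*} [AddCommMonoid E] [SMul G E]
    {F : Finset ι} {j : ι} (hj : j ∉ F) (s : ι → G) (c : G) (z : ι → E) :
    ∑ i ∈ insert j F, Function.update s j c i • z i = c • z j + ∑ i ∈ F, s i • z i := by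
  rw [Finset.sum_insert hj, Function.update_self]
  congr 1
  exact Finset.sum_congr rfl fun i hi => by rw [Function.update_of_ne (ne_of_mem_of_not_mem hi hj)]

theorem norm_add_sum_le_of_signed_sums (β : X →L[𝕜] Y →L[𝕜] Z) (u : ι → X) (v : ι → Y) (M : ℝ)
    (F : Finset ι) : ∀ (x : X) (y : Y),
      (∀ s : ι → ℤˣ, ‖β (x + ∑ i ∈ F, s i • u i) (y + ∑ i ∈ F, s i • v i)‖ ≤ M) →
      ‖β x y + ∑ i ∈ F, β (u i) (v i)‖ ≤ M := by
  classical
  induction F using Finset.induction_on with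
  | empty => exact fun x y h => by simpa using h 1
  | insert j F hj ih =>
    intro x y h
    set S := ∑ i ∈ F, β (u i) (v i)
    have hsign : ∀ c : ℤˣ, ‖β (x + c • u j) (y + c • v j) + S‖ ≤ M := fun c =>
      ih _ _ fun s => by
        simpa only [sum_insert_update_smul hj, add_assoc] using h (Function.update s j c)
    have hparallelogram : β x y + (β (u j) (v j) + S) = (2⁻¹ : 𝕜) •
        ((β (x + u j) (y + v j) + S) + (β (x - u j) (y - v j) + S)) := by
      simp only [map_add, map_sub, add_apply, sub_apply]
      module
    rw [Finset.sum_insert hj, hparallelogram, norm_smul, norm_inv, RCLike.norm_two]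
    have hadd := norm_add_le_of_le (hsign 1) (hsign (-1))
    simp only [one_smul, Units.neg_smul, ← sub_eq_add_neg] at hadd
    linarith

theorem SignBounded.norm_sum_le {F : Finset ι} {u : ι → X} {v : ι → Y} {p q : ℝ}
    (hu : SignBounded F u p) (hv : SignBounded F v q) (β : X →L[𝕜] Y →L[𝕜] Z) :
    ‖∑ i ∈ F, β (u i) (v i)‖ ≤ ‖β‖ * p * q := by
  have h := norm_add_sum_le_of_signed_sums β u v (‖β‖ * p * q) F 0 0 fun s => by
    rw [zero_add, zero_add]
    exact β.le_of_opNorm₂_le_of_le le_rfl (hu s) (hv s)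
  simpa using h

theorem summable_of_signBounded [CompleteSpace Z] {u : ι → X} {v : ι → Y} {q : ℝ}
    (hu : ∀ δ > 0, ∃ F₀ : Finset ι, ∀ F, Disjoint F F₀ → SignBounded F u δ)
    (hv : ∀ F, SignBounded F v q) (β : X →L[𝕜] Y →L[𝕜] Z) : Summable fun i => β (u i) (v i) := by
  refine summable_iff_vanishing_norm.2 fun ε hε => ?_
  have hM : 0 ≤ ‖β‖ * q := mul_nonneg (norm_nonneg β) (hv ∅).nonneg
  obtain ⟨F₀, hF₀⟩ := hu (ε / (‖β‖ * q + 1)) (by positivity)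
  refine ⟨F₀, fun F hF => ?_⟩
  calc ‖∑ i ∈ F, β (u i) (v i)‖ ≤ ‖β‖ * (ε / (‖β‖ * q + 1)) * q :=
        (hF₀ F hF).norm_sum_le (hv F) β
    _ = ε * ((‖β‖ * q) / (‖β‖ * q + 1)) := by ring
    _ < ε := mul_lt_of_lt_one_right hε ((div_lt_one (by positivity)).2 (lt_add_one _))

end SignAveraging

section ApproximateDiagonal

variable {R : Type w} [NonUnitalNormedRing R] [NormedSpace ℂ R] [IsScalarTower ℂ R R]
  [SMulCommClass ℂ R R]

/-- The module right inverse of `φ` is `a ↦ ∑ i, a E i · σ (E i)`, the image of the formal diagonal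
`∑ i, E i ⊗ E i` multiplied by `a`. -/
theorem isLeftProjective_of_signBounded {ι : Type*} (E : ι → R) (N : ℝ)
    (hN : ∀ F, SignBounded F E N)
    (htail : ∀ a : R, ∀ δ > 0, ∃ F₀ : Finset ι, ∀ F, Disjoint F F₀ →
      SignBounded F (fun i => a * E i) δ)
    (hsum : ∀ a b, HasSum (fun i => a * E i * E i) b → b = a) : IsLeftProjective R := by
  intro Y _ _ _ mY φ hφ ⟨σ, hσ⟩
  have hσE : ∀ F, SignBounded F (fun i => σ (E i)) (‖σ‖ * N) := fun F => (hN F).map σ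
  have hsummable : ∀ a, Summable fun i => mY.act (a * E i) (σ (E i)) := fun a =>
    summable_of_signBounded (htail a) hσE mY.act
  have hbound : ∀ a, ‖∑' i, mY.act (a * E i) (σ (E i))‖ ≤ ‖mY.act‖ * N * (‖σ‖ * N) * ‖a‖ := by
    refine fun a => le_of_tendsto (hsummable a).hasSum.norm (Eventually.of_forall fun F => ?_)
    have haE : SignBounded F (fun i => a * E i) (‖a‖ * N) := fun s =>
      (((hN F).map (ContinuousLinearMap.mul ℂ R a)) s).trans
        (mul_le_mul_of_nonneg_right (ContinuousLinearMap.opNorm_mul_apply_le ℂ R a) (hN ∅).nonneg)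
    exact (haE.norm_sum_le (hσE F) mY.act).trans_eq (by ring)
  let ψ : R →L[ℂ] Y := LinearMap.mkContinuous
    { toFun := fun a => ∑' i, mY.act (a * E i) (σ (E i))
      map_add' := fun a b => by
        simp only [add_mul, map_add, add_apply, (hsummable a).tsum_add (hsummable b)]
      map_smul' := fun c a => by
        simp only [smul_mul_assoc, map_smul, smul_apply, RingHom.id_apply,
          (hsummable a).tsum_const_smul] } _ hbound
  have hψ : ∀ a, HasSum (fun i => mY.act (a * E i) (σ (E i))) (ψ a) := fun a => (hsummable a).hasSum
  refine ⟨ψ, fun a b => ?_, fun a => hsum a _ ?_⟩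
  · refine (hψ (a * b)).unique ?_
    have h := (mY.act a).hasSum (hψ b)
    simpa only [← mY.mul_act, ← mul_assoc] using h
  · have h := φ.hasSum (hψ a)
    simp only [hφ, hσ] at h
    exact h

end ApproximateDiagonal

section Cohomology

variable {R : Type w} [NonUnitalNormedRing R] [NormedSpace ℂ R]

namespace LeftBanachModule

variable {Y : Type w} [NormedAddCommGroup Y] [NormedSpace ℂ Y]

/-- The kernel of a morphism of left Banach modules `φ : Y → R`, as a bimodule with zero right
multiplication. -/
noncomputable def kerBimodule (mY : LeftBanachModule R Y) (φ : Y →L[ℂ] R)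
    (hφ : ∀ a y, φ (mY.act a y) = a * φ y) : BanachBimodule R φ.ker where
  left := LinearMap.mkContinuous₂
    (LinearMap.mk₂ ℂ
      (fun a (y : φ.ker) => (⟨mY.act a y, by simp [hφ, show φ y = 0 from y.2]⟩ : φ.ker))
      (fun a b y => by ext; simp)
      (fun c a y => by ext; simp)
      (fun a y z => by ext; simp)
      (fun c a y => by ext; simp))
    ‖mY.act‖ fun a y => mY.act.le_opNorm₂ a y
  right := 0
  mul_left := fun a b y => Subtype.ext (mY.mul_act a b y)
  mul_right := fun _ _ _ => rfl
  left_right := fun _ _ _ => (map_zero _).symm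

open ContinuousLinearMap in
/-- The failure `(a, b) ↦ a · σ b - σ (a * b)` of a linear right inverse `σ` of `φ` to be a
morphism of modules, see `coe_splittingCocycle`. -/
noncomputable def splittingCocycle (mY : LeftBanachModule R Y) (φ : Y →L[ℂ] R) (σ : R →L[ℂ] Y)
    (hσ : Function.RightInverse σ φ) : R →L[ℂ] R →L[ℂ] φ.ker :=
  (compL ℂ R Y φ.ker (φ.projKerOfRightInverse σ hσ)).comp (((compL ℂ R Y Y).flip σ).comp mY.act)

theorem coe_splittingCocycle (mY : LeftBanachModule R Y) {φ : Y →L[ℂ] R}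
    (hφ : ∀ a y, φ (mY.act a y) = a * φ y) {σ : R →L[ℂ] Y} (hσ : Function.RightInverse σ φ)
    (a b : R) : (mY.splittingCocycle φ σ hσ a b : Y) = mY.act a (σ b) - σ (a * b) := by
  simp [splittingCocycle, hφ, hσ b]

end LeftBanachModule

variable [IsScalarTower ℂ R R] [SMulCommClass ℂ R R]

namespace BanachBimodule

variable {X : Type w} [NormedAddCommGroup X] [NormedSpace ℂ X]

open ContinuousLinearMap in
/-- The extension of the left Banach module `R` by `X` defined by a bounded 2-cocycle `g`, see
`extension_act`. -/
noncomputable def extension (m : BanachBimodule R X) (hm : m.IsRightAnnihilator)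
    (g : R →L[ℂ] R →L[ℂ] X) (hg : m.δ₂ g = 0) : LeftBanachModule R (X × R) where
  act := (compL ℂ (X × R) X (X × R) (inl ℂ X R)).comp
      (((compL ℂ (X × R) X X).flip (fst ℂ X R)).comp m.left +
        ((compL ℂ (X × R) R X).flip (snd ℂ X R)).comp g) +
    (compL ℂ (X × R) R (X × R) (inr ℂ X R)).comp
      (((compL ℂ (X × R) R R).flip (snd ℂ X R)).comp (mul ℂ R))
  mul_act := fun a b p => by
    have hcocycle : m.left a (g b p.2) + g a (b * p.2) = g (a * b) p.2 := by
      have h := m.δ₂_apply g a b p.2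
      rw [hg, hm, sub_zero, sub_add_eq_add_sub] at h
      exact sub_eq_zero.1 h.symm
    ext <;> simp [m.mul_left, mul_assoc, ← hcocycle, add_assoc]

theorem extension_act (m : BanachBimodule R X) (hm : m.IsRightAnnihilator)
    (g : R →L[ℂ] R →L[ℂ] X) (hg : m.δ₂ g = 0) (a : R) (p : X × R) :
    (m.extension hm g hg).act a p = (m.left a p.1 + g a p.2, a * p.2) := by
  simp [extension]

end BanachBimodule

theorem IsLeftProjective.h2VanishesOnRightAnnihilators [CompleteSpace R]
    (hR : IsLeftProjective R) : H2VanishesOnRightAnnihilators R := by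
  intro X _ _ _ m hm
  refine m.subsingleton_H2_iff.2 fun g hg => ?_
  obtain ⟨ψ, hψ, hsnd⟩ := hR (X × R) (m.extension hm g hg) (ContinuousLinearMap.snd ℂ X R)
    (fun a p => by rw [m.extension_act]; rfl) ⟨ContinuousLinearMap.inr ℂ X R, fun _ => rfl⟩
  refine ⟨-(ContinuousLinearMap.fst ℂ X R).comp ψ, ?_⟩
  ext a b
  have hfst : (ψ (a * b)).1 = m.left a (ψ b).1 + g a b := by
    have h := congrArg Prod.fst (hψ a b)
    rwa [m.extension_act, show (ψ b).2 = b from hsnd b] at h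
  rw [m.δ₁_apply, hm]
  simp [hfst]

theorem LeftBanachModule.δ₂_splittingCocycle {Y : Type w} [NormedAddCommGroup Y]
    [NormedSpace ℂ Y] (mY : LeftBanachModule R Y) {φ : Y →L[ℂ] R}
    (hφ : ∀ a y, φ (mY.act a y) = a * φ y) {σ : R →L[ℂ] Y} (hσ : Function.RightInverse σ φ) :
    (mY.kerBimodule φ hφ).δ₂ (mY.splittingCocycle φ σ hσ) = 0 := by
  have hleft : ∀ a y, ((mY.kerBimodule φ hφ).left a y : Y) = mY.act a y := fun _ _ => rfl
  have hright : ∀ a y, (mY.kerBimodule φ hφ).right a y = 0 := fun _ _ => rfl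
  ext a b c
  simp only [BanachBimodule.δ₂_apply, hright, sub_zero, zero_apply, Submodule.coe_add,
    Submodule.coe_sub, mY.coe_splittingCocycle hφ, hleft, map_sub, mY.mul_act, mul_assoc,
    Submodule.coe_zero]
  abel

theorem H2VanishesOnRightAnnihilators.isLeftProjective (hR : H2VanishesOnRightAnnihilators R) :
    IsLeftProjective R := by
  intro Y _ _ _ mY φ hφ ⟨σ, hσ⟩
  replace hφ : ∀ a y, φ (mY.act a y) = a * φ y := hφ
  have : CompleteSpace φ.ker := φ.isClosed_ker.completeSpace_coe
  obtain ⟨f, hf⟩ := (mY.kerBimodule φ hφ).subsingleton_H2_iff.1 (hR φ.ker _ fun _ _ => rfl)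
    (mY.splittingCocycle φ σ hσ) (mY.δ₂_splittingCocycle hφ hσ)
  have hcoboundary : ∀ a b, mY.act a (f b) - f (a * b) = mY.act a (σ b) - σ (a * b) := fun a b => by
    have h := congrArg (fun g => (g a b : Y)) hf
    rwa [BanachBimodule.δ₁_apply, show (mY.kerBimodule φ hφ).right b (f a) = 0 from rfl, add_zero,
      mY.coe_splittingCocycle hφ] at h
  refine ⟨σ - φ.ker.subtypeL.comp f, fun a b => ?_, fun b => ?_⟩
  · change σ (a * b) - f (a * b) = mY.act a (σ b - f b)
    rw [map_sub]
    linear_combination (norm := module) hcoboundary a b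
  · simp [hσ, show φ (f b) = 0 from (f b).2]

theorem isLeftProjective_iff_h2VanishesOnRightAnnihilators [CompleteSpace R] :
    IsLeftProjective R ↔ H2VanishesOnRightAnnihilators R :=
  ⟨fun h => h.h2VanishesOnRightAnnihilators, fun h => h.isLeftProjective⟩

end Cohomology

section FieldSections

variable {Ω : Type u} [TopologicalSpace Ω] {A : Ω → Type v}
  [∀ t, NonUnitalNormedRing (A t)] [∀ t, NormedSpace ℂ (A t)]

namespace ContinuousField

theorem continuousAt_iff_forall_exists_norm_sub_le (U : ContinuousField Ω A) {S B : Type*}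
    [TopologicalSpace S] [NormedAddCommGroup B] [NormedSpace ℂ B] {j : S → Ω}
    (T : ∀ s, A (j s) ≃ₗᵢ[ℂ] B) (hT : ∀ z ∈ U.Θ, Continuous fun s => T s (z (j s)))
    {x : ∀ s, A (j s)} {s₀ : S} :
    ContinuousAt (fun s => T s (x s)) s₀ ↔
      ∀ ε > 0, ∃ z ∈ U.Θ, ∀ᶠ s in 𝓝 s₀, ‖x s - z (j s)‖ ≤ ε := by
  have hdist : ∀ s (z : ∀ t, A t), dist (T s (x s)) (T s (z (j s))) = ‖x s - z (j s)‖ :=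
    fun s z => by rw [(T s).dist_map, dist_eq_norm]
  constructor
  · intro hx ε hε
    obtain ⟨-, ⟨z, hz, rfl⟩, hxz⟩ := Metric.mem_closure_iff.1 (U.dense_eval (j s₀) (x s₀)) ε hε
    refine ⟨z, hz, ?_⟩
    have hlt := (hx.dist (hT z hz).continuousAt).eventually_lt_const
      (((T s₀).dist_map _ _).trans_lt hxz)
    filter_upwards [hlt] with s hs
    exact (hdist s z).symm.trans_le hs.le
  · intro happrox
    refine continuousAt_of_locally_uniform_approx_of_continuousAt fun u hu => ?_
    obtain ⟨ε, hε, hεu⟩ := Metric.mem_uniformity_dist.1 hu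
    obtain ⟨z, hz, hxz⟩ := happrox (ε / 2) (half_pos hε)
    exact ⟨_, hxz, _, (hT z hz).continuousAt, fun s hs =>
      hεu ((hdist s z).trans_lt (lt_of_le_of_lt hs (half_lt_self hε)))⟩

theorem comp_val_mem_restrict (U : ContinuousField Ω A) {x : ∀ t, A t} (hx : x ∈ U.Θ)
    (Y : Set Ω) : (fun t : Y => x t) ∈ (U.restrict Y).Θ :=
  fun _ _ hε => ⟨x, hx, Eventually.of_forall fun _ => by simpa using hε.le⟩

theorem continuous_iso_restrict {U : ContinuousField Ω A} {V : Set Ω} {B : Type v}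
    [NonUnitalNormedRing B] [NormedSpace ℂ B] (Φ : (U.restrict V).Iso (const V B))
    {x : ∀ t, A t} (hx : x ∈ U.Θ) : Continuous fun t : V => Φ.toFun t (x t) :=
  (Φ.mem_iff _).1 (U.comp_val_mem_restrict hx V)

theorem mem_restrict_restrict_iff (U : ContinuousField Ω A) {W : Set Ω} {O : Set W}
    {x : ∀ p : O, A p} : x ∈ ((U.restrict W).restrict O).Θ ↔
      ∀ p, ∀ ε > 0, ∃ z ∈ U.Θ, ∀ᶠ q : O in 𝓝 p, ‖x q - z q‖ ≤ ε := by
  constructor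
  · intro hx p ε hε
    obtain ⟨y, hy, hxy⟩ := hx p (ε / 2) (half_pos hε)
    obtain ⟨z, hz, hyz⟩ := hy p (ε / 2) (half_pos hε)
    refine ⟨z, hz, ?_⟩
    filter_upwards [hxy, continuous_subtype_val.continuousAt.eventually hyz] with q hq hq'
    exact (norm_sub_le_norm_sub_add_norm_sub _ _ _).trans
      ((add_le_add hq hq').trans_eq (add_halves ε))
  · intro hx p ε hε
    obtain ⟨z, hz, hxz⟩ := hx p ε hε
    exact ⟨_, U.comp_val_mem_restrict hz W, hxz⟩

theorem isTrivial_restrict_restrict (U : ContinuousField Ω A) {V W : Set Ω}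
    (hV : (U.restrict V).IsTrivial) : ((U.restrict W).restrict (Subtype.val ⁻¹' V)).IsTrivial := by
  obtain ⟨B, _, _, h₁, h₂, h₃, ⟨Φ⟩⟩ := hV
  let j : (Subtype.val ⁻¹' V : Set W) → V := fun p => ⟨p.1, p.2⟩
  have hj : Continuous j := by fun_prop
  refine ⟨B, _, _, h₁, h₂, h₃, ⟨⟨fun p => Φ.toFun (j p), fun p => Φ.map_mul (j p), fun x => ?_⟩⟩⟩
  refine U.mem_restrict_restrict_iff.trans (Iff.trans ?_ continuous_iff_continuousAt.symm)
  exact forall_congr' fun p => (U.continuousAt_iff_forall_exists_norm_sub_le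
    (fun q => Φ.toFun (j q)) fun z hz => (continuous_iso_restrict Φ hz).comp hj).symm

theorem IsLocallyTrivial.isSigmaLocallyTrivial_restrict {U : ContinuousField Ω A}
    (hU : U.IsLocallyTrivial) (W : Set Ω) [SigmaCompactSpace W] [RegularSpace Ω] :
    (U.restrict W).IsSigmaLocallyTrivial := by
  choose V hVo hV hVt using fun y : W => hU y
  let O : W → Set W := fun y => Subtype.val ⁻¹' V y
  have hO : ∀ y, IsOpen (O y) := fun y => (hVo y).preimage continuous_subtype_val
  have hshrink : ∀ y, ∃ S : Set W, IsOpen S ∧ y ∈ S ∧ closure S ⊆ O y := fun y => by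
    obtain ⟨S, hS, hcS⟩ := exists_mem_nhds_isClosed_subset ((hO y).mem_nhds (hV y))
    exact ⟨interior S, isOpen_interior, mem_interior_iff_mem_nhds.2 hS,
      (closure_minimal interior_subset hcS.1).trans hcS.2⟩
  choose S hSo hS hSO using hshrink
  obtain ⟨D, hD, hDS⟩ := countable_cover_nhds_of_sigmaCompact fun y => (hSo y).mem_nhds (hS y)
  refine ⟨range O, ?_, ?_, S '' D, hD.image S, ?_, (sUnion_image S D).trans hDS⟩
  · rintro _ ⟨y, rfl⟩
    exact ⟨hO y, U.isTrivial_restrict_restrict (hVt y)⟩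
  · exact eq_univ_of_forall fun y => ⟨O y, ⟨y, rfl⟩, hV y⟩
  · rintro _ ⟨y, -, rfl⟩
    exact ⟨hSo y, O y, ⟨y, rfl⟩, hSO y⟩

theorem IsLocallyTrivial.isDisjointUnionOfSigmaLocallyTrivial [T2Space Ω] [LocallyCompactSpace Ω]
    [ParacompactSpace Ω] {U : ContinuousField Ω A} (hU : U.IsLocallyTrivial) :
    U.IsDisjointUnionOfSigmaLocallyTrivial := by
  obtain ⟨R, hR⟩ := IsProperDiagonalNhd.exists_of_paracompact (Ω := Ω)
  obtain ⟨P⟩ := hR.nonempty_exhaustedPartition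
  refine ⟨range fun i => P.part ⁻¹' {i}, ?_, ?_, ?_, ?_⟩
  · rintro _ ⟨i, rfl⟩
    exact (P.isClopen_fiber i).isOpen
  · exact (pairwise_disjoint_fiber P.part).range_pairwise
  · exact eq_univ_of_forall fun x => ⟨_, ⟨P.part x, rfl⟩, rfl⟩
  · rintro _ ⟨i, rfl⟩
    have := P.sigmaCompactSpace_fiber i
    exact hU.isSigmaLocallyTrivial_restrict _

/-- A trivialisation of `U` near `s`, normalised to take its values in the fibre at `s`. -/
structure LocalTrivialization (U : ContinuousField Ω A) (s : Ω) where
  /-- The neighbourhood of `s` over which the field is trivialised. -/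
  base : Set Ω
  isOpen_base : IsOpen base
  mem_base : s ∈ base
  /-- The identification of the fibre at `t` with the fibre at `s`. -/
  toFibre : ∀ t : base, A t ≃ₗᵢ[ℂ] A s
  map_mul : ∀ t a b, toFibre t (a * b) = toFibre t a * toFibre t b
  continuous : ∀ x ∈ U.Θ, Continuous fun t : base => toFibre t (x t)

theorem IsLocallyTrivial.nonempty_localTrivialization {U : ContinuousField Ω A}
    (hU : U.IsLocallyTrivial) (s : Ω) : Nonempty (U.LocalTrivialization s) := by
  obtain ⟨V, hV, hs, B, _, _, _, _, _, ⟨Φ⟩⟩ := hU s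
  exact ⟨{
    base := V
    isOpen_base := hV
    mem_base := hs
    toFibre := fun t => (Φ.toFun t).trans (Φ.toFun ⟨s, hs⟩).symm
    map_mul := fun t a b => (Φ.toFun ⟨s, hs⟩).injective (by simp [Φ.map_mul])
    continuous := fun x hx =>
      (Φ.toFun ⟨s, hs⟩).symm.continuous.comp (continuous_iso_restrict Φ hx) }⟩

/-- The centre `s` of a local trivialisation, as a point of its base. -/
abbrev LocalTrivialization.center {U : ContinuousField Ω A} {s : Ω} (L : U.LocalTrivialization s) :
    L.base := ⟨s, L.mem_base⟩

theorem mem_of_continuousAt_localTrivialization {U : ContinuousField Ω A}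
    (L : ∀ s, U.LocalTrivialization s) {x : ∀ t, A t}
    (hx : ∀ s, ContinuousAt (fun t => (L s).toFibre t (x t)) (L s).center) : x ∈ U.Θ := by
  refine U.mem_of_locally_approx x fun s ε hε => ?_
  obtain ⟨z, hz, hxz⟩ :=
    (U.continuousAt_iff_forall_exists_norm_sub_le _ (L s).continuous).1 (hx s) ε hε
  refine ⟨z, hz, ?_⟩
  rwa [← (L s).isOpen_base.isOpenEmbedding_subtypeVal.map_nhds_eq (L s).center, eventually_map]

theorem IsLocallyTrivial.unit_mem {U : ContinuousField Ω A} (hU : U.IsLocallyTrivial)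
    {e : ∀ t, A t} (he : ∀ t (a : A t), e t * a = a ∧ a * e t = a) : e ∈ U.Θ := by
  let L := fun s => (hU.nonempty_localTrivialization s).some
  refine mem_of_continuousAt_localTrivialization L fun s => ?_
  have hconst : ∀ t, (L s).toFibre t (e t) = e s := fun t => by
    obtain ⟨a, ha⟩ := ((L s).toFibre t).surjective (e s)
    rw [← (he s ((L s).toFibre t (e t))).2, ← ha, ← (L s).map_mul, (he t a).1]
  simpa only [hconst] using continuousAt_const

theorem smul_mem (U : ContinuousField Ω A) {x : ∀ t, A t} (hx : x ∈ U.Θ) {f : Ω → ℂ}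
    (hf : Continuous f) : (fun t => f t • x t) ∈ U.Θ := by
  refine U.mem_of_locally_approx _ fun t ε hε => ⟨f t • x, SMulMemClass.smul_mem _ hx, ?_⟩
  have hcont : Continuous fun s => ‖f s - f t‖ * ‖x s‖ :=
    (hf.sub continuous_const).norm.mul (U.continuous_norm x hx)
  filter_upwards [hcont.continuousAt.eventually_lt_const (by simpa using hε)] with s hs
  rw [Pi.smul_apply, ← sub_smul, norm_smul]
  exact hs.le

/-- The multiple of a continuous vector field by a compactly supported scalar function. -/
noncomputable def cutoff (U : ContinuousField Ω A) {x : ∀ t, A t} (hx : x ∈ U.Θ) (f : C_c(Ω, ℝ)) :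
    U.sectionAlgebra :=
  have hmem : (fun t => (f t : ℂ) • x t) ∈ U.Θ :=
    U.smul_mem hx (Complex.continuous_ofReal.comp f.continuous)
  have hzero : Tendsto (fun t => ‖(f t : ℂ) • x t‖) (cocompact Ω) (𝓝 0) :=
    tendsto_const_nhds.congr' <|
      mem_of_superset f.hasCompactSupport.compl_mem_cocompact fun t ht => by
        simp [image_eq_zero_of_notMem_tsupport ht]
  ⟨⟨_, U.memℓp_of_tendsto hmem hzero⟩, hmem, hzero⟩

/-- Evaluation of sections at a point. -/
noncomputable def evalCLM (U : ContinuousField Ω A) (t : Ω) : U.sectionAlgebra →L[ℂ] A t :=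
  LinearMap.mkContinuous
    { toFun := fun a => (a : lp A ∞) t
      map_add' := fun _ _ => rfl
      map_smul' := fun _ _ => rfl } 1 fun a => by
    rw [one_mul]
    exact lp.norm_apply_le_norm ENNReal.top_ne_zero (a : lp A ∞) t

theorem evalCLM_cutoff (U : ContinuousField Ω A) {x : ∀ t, A t} (hx : x ∈ U.Θ) (f : C_c(Ω, ℝ))
    (t : Ω) : U.evalCLM t (U.cutoff hx f) = (f t : ℂ) • x t := rfl

theorem evalCLM_mul (U : ContinuousField Ω A) (t : Ω) (a b : U.sectionAlgebra) :
    U.evalCLM t (a * b) = U.evalCLM t a * U.evalCLM t b := rfl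

theorem norm_evalCLM_le (U : ContinuousField Ω A) (t : Ω) (a : U.sectionAlgebra) :
    ‖U.evalCLM t a‖ ≤ ‖a‖ := lp.norm_apply_le_norm ENNReal.top_ne_zero (a : lp A ∞) t

theorem norm_le_of_forall_evalCLM_le (U : ContinuousField Ω A) {a : U.sectionAlgebra} {c : ℝ}
    (hc : 0 ≤ c) (h : ∀ t, ‖U.evalCLM t a‖ ≤ c) : ‖a‖ ≤ c :=
  lp.norm_le_of_forall_le (f := (a : lp A ∞)) hc h

theorem section_ext (U : ContinuousField Ω A) {a b : U.sectionAlgebra}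
    (h : ∀ t, U.evalCLM t a = U.evalCLM t b) : a = b :=
  Subtype.ext (Subtype.ext (funext h))

theorem cutoff_mul_cutoff (U : ContinuousField Ω A) [∀ t, IsScalarTower ℂ (A t) (A t)]
    [∀ t, SMulCommClass ℂ (A t) (A t)] {e : ∀ t, A t} (he : ∀ t (a : A t), e t * a = a)
    (hmem : e ∈ U.Θ) (f g : C_c(Ω, ℝ)) :
    U.cutoff hmem f * U.cutoff hmem g = U.cutoff hmem (f * g) :=
  U.section_ext fun t => by
    simp only [evalCLM_mul, evalCLM_cutoff, smul_mul_smul_comm, he,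
      CompactlySupportedContinuousMap.mul_apply, Complex.ofReal_mul]

end ContinuousField

end FieldSections

section Projectivity

variable {Ω : Type u} [TopologicalSpace Ω] {A : Ω → Type v}
  [∀ t, NonUnitalNormedRing (A t)] [∀ t, NormedSpace ℂ (A t)]
  {ι : Type*} {k : ι → C_c(Ω, ℝ)}

theorem IsSquarePartition.norm_sum_sign_smul_le (hk : IsSquarePartition k) {E : Type*}
    [NormedAddCommGroup E] [NormedSpace ℂ E] (F : Finset ι) (s : ι → ℤˣ) (t : Ω) (a : E) :
    ‖∑ i ∈ F, s i • (k i t : ℂ) • a‖ ≤ 2 * ‖a‖ := by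
  have hterm : ∀ i ∈ F, ‖s i • (k i t : ℂ) • a‖ ≤ k i t * ‖a‖ := fun i _ => by
    rw [norm_units_zsmul, norm_smul, Complex.norm_real, Real.norm_of_nonneg (hk.nonneg i t)]
  calc ‖∑ i ∈ F, s i • (k i t : ℂ) • a‖ ≤ ∑ i ∈ F, k i t * ‖a‖ := norm_sum_le_of_le F hterm
    _ = (∑ i ∈ F, k i t) * ‖a‖ := (Finset.sum_mul ..).symm
    _ ≤ 2 * ‖a‖ := mul_le_mul_of_nonneg_right (hk.sum_le_two t F) (norm_nonneg a)

namespace ContinuousField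

theorem evalCLM_sum_sign_smul (U : ContinuousField Ω A) (F : Finset ι) (s : ι → ℤˣ)
    (E : ι → U.sectionAlgebra) (t : Ω) :
    U.evalCLM t (∑ i ∈ F, s i • E i) = ∑ i ∈ F, s i • U.evalCLM t (E i) := by
  simp only [map_sum, Units.smul_def, map_zsmul]

variable {U : ContinuousField Ω A} {e : ∀ t, A t}

theorem signBounded_cutoff (hk : IsSquarePartition k) (hmem : e ∈ U.Θ) {C : ℝ}
    (hC : ∀ t, ‖e t‖ ≤ C) (F : Finset ι) :
    SignBounded F (fun i => U.cutoff hmem (k i)) (2 * max C 0) := fun s => by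
  refine U.norm_le_of_forall_evalCLM_le (by positivity) fun t => ?_
  simp only [evalCLM_sum_sign_smul, evalCLM_cutoff]
  exact (hk.norm_sum_sign_smul_le F s t (e t)).trans
    (mul_le_mul_of_nonneg_left ((hC t).trans (le_max_left _ _)) zero_le_two)

variable [∀ t, SMulCommClass ℂ (A t) (A t)]

theorem evalCLM_mul_cutoff (he : ∀ t (a : A t), a * e t = a) (hmem : e ∈ U.Θ)
    (a : U.sectionAlgebra) (f : C_c(Ω, ℝ)) (t : Ω) :
    U.evalCLM t (a * U.cutoff hmem f) = (f t : ℂ) • U.evalCLM t a := by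
  rw [evalCLM_mul, evalCLM_cutoff, mul_smul_comm, he]

theorem exists_forall_disjoint_signBounded_mul_cutoff (hk : IsSquarePartition k)
    (he : ∀ t (a : A t), a * e t = a) (hmem : e ∈ U.Θ) (a : U.sectionAlgebra) {δ : ℝ}
    (hδ : 0 < δ) : ∃ F₀ : Finset ι, ∀ F, Disjoint F F₀ →
      SignBounded F (fun i => a * U.cutoff hmem (k i)) δ := by
  obtain ⟨K, hK, hKa⟩ := mem_cocompact.1 (a.2.2.eventually_lt_const (half_pos hδ))
  have hfin := hk.locallyFinite.finite_nonempty_inter_compact hK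
  refine ⟨hfin.toFinset, fun F hF s => U.norm_le_of_forall_evalCLM_le hδ.le fun t => ?_⟩
  simp only [evalCLM_sum_sign_smul, evalCLM_mul_cutoff he]
  by_cases ht : t ∈ K
  · have hzero : ∀ i ∈ F, s i • (k i t : ℂ) • U.evalCLM t a = 0 := fun i hi => by
      have hi' : k i t = 0 := by
        by_contra hne
        exact Finset.disjoint_left.1 hF hi (hfin.mem_toFinset.2 ⟨t, hne, ht⟩)
      rw [hi', Complex.ofReal_zero, zero_smul, smul_zero]
    rw [Finset.sum_eq_zero hzero, norm_zero]
    exact hδ.le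
  · have hat : ‖U.evalCLM t a‖ < δ / 2 := hKa ht
    linarith [hk.norm_sum_sign_smul_le F s t (U.evalCLM t a)]

theorem isLeftProjective_of_paracompactSpace [T2Space Ω] [LocallyCompactSpace Ω]
    [ParacompactSpace Ω] [∀ t, IsScalarTower ℂ (A t) (A t)] (he : ∀ t (a : A t), a * e t = a)
    (hmem : e ∈ U.Θ) {C : ℝ} (hC : ∀ t, ‖e t‖ ≤ C) : IsLeftProjective U.sectionAlgebra := by
  obtain ⟨ι, k, hk⟩ := exists_isSquarePartition (Ω := Ω)
  refine isLeftProjective_of_signBounded (fun i => U.cutoff hmem (k i)) (2 * max C 0)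
    (signBounded_cutoff hk hmem hC)
    (fun a _ => exists_forall_disjoint_signBounded_mul_cutoff hk he hmem a)
    fun a b hb => U.section_ext fun t => ?_
  have hsum := (U.evalCLM t).hasSum hb
  have hterm : ∀ i, U.evalCLM t (a * U.cutoff hmem (k i) * U.cutoff hmem (k i)) =
      ((k i t ^ 2 : ℝ) : ℂ) • U.evalCLM t a := fun i => by
    rw [evalCLM_mul_cutoff he, evalCLM_mul_cutoff he, smul_smul, ← Complex.ofReal_mul, ← pow_two]
  simp only [hterm] at hsum
  have hone : HasSum (fun i => ((k i t ^ 2 : ℝ) : ℂ)) ((1 : ℝ) : ℂ) :=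
    Complex.ofRealCLM.hasSum (hk.hasSum_sq t)
  simpa using hsum.unique (hone.smul_const (U.evalCLM t a))

end ContinuousField

end Projectivity

section FibreFamilies

variable {Ω : Type u} {A : Ω → Type v} [∀ t, NonUnitalNormedRing (A t)]
  [∀ t, NormedSpace ℂ (A t)]

/-- A linear isometric isomorphism between two fibres. -/
structure FibreIsometry (A : Ω → Type v) [∀ t, NonUnitalNormedRing (A t)]
    [∀ t, NormedSpace ℂ (A t)] where
  /-- The base point of the target. -/
  tgt : Ω
  /-- The base point of the source. -/
  src : Ω
  /-- The isomorphism. -/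
  iso : A src ≃ₗᵢ[ℂ] A tgt

/-- The identity of the fibre at `s`. -/
abbrev FibreIsometry.refl (A : Ω → Type v) [∀ t, NonUnitalNormedRing (A t)]
    [∀ t, NormedSpace ℂ (A t)] (s : Ω) : FibreIsometry A :=
  ⟨s, s, LinearIsometryEquiv.refl ℂ (A s)⟩

/-- The bounded families which assign to each isometry between fibres a vector of its target. They
play the part of functions of two variables `(s, t)` with values in `A s`; indexing by isometries
`A t ≃ A s` makes sections of the second variable into families, see `FibreFamily.ofSource`. -/
abbrev FibreFamily (A : Ω → Type v) [∀ t, NonUnitalNormedRing (A t)]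
    [∀ t, NormedSpace ℂ (A t)] : Type (max u v) := lp (fun i : FibreIsometry A => A i.tgt) ∞

namespace FibreFamily

theorem lipschitzWith_apply (i : FibreIsometry A) :
    LipschitzWith 1 fun F : FibreFamily A => F i :=
  LipschitzWith.of_dist_le_mul fun F G => by
    rw [NNReal.coe_one, one_mul, dist_eq_norm, dist_eq_norm]
    exact lp.norm_apply_le_norm ENNReal.top_ne_zero (F - G) i

variable [TopologicalSpace Ω] {U : ContinuousField Ω A}

/-- A section as a family that depends on the target only. -/
noncomputable def ofTarget (a : U.sectionAlgebra) : FibreFamily A :=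
  ⟨fun i => U.evalCLM i.tgt a, memℓp_infty ⟨‖a‖, by
    rintro _ ⟨i, rfl⟩
    exact U.norm_evalCLM_le _ a⟩⟩

theorem norm_ofTarget_le (a : U.sectionAlgebra) : ‖ofTarget a‖ ≤ ‖a‖ :=
  lp.norm_le_of_forall_le (norm_nonneg a) fun i => U.norm_evalCLM_le i.tgt a

/-- A section as a family that depends on the source only, transported to the target. -/
noncomputable def ofSource (a : U.sectionAlgebra) : FibreFamily A :=
  ⟨fun i => i.iso (U.evalCLM i.src a), memℓp_infty ⟨‖a‖, by
    rintro _ ⟨i, rfl⟩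
    exact (i.iso.norm_map _).trans_le (U.norm_evalCLM_le _ a)⟩⟩

theorem norm_ofSource_le (a : U.sectionAlgebra) : ‖ofSource a‖ ≤ ‖a‖ :=
  lp.norm_le_of_forall_le (norm_nonneg a)
    fun i => (i.iso.norm_map _).trans_le (U.norm_evalCLM_le i.src a)

end FibreFamily

namespace ContinuousField

variable [TopologicalSpace Ω] {U : ContinuousField Ω A}

namespace LocalTrivialization

variable {s : Ω} (L : U.LocalTrivialization s)

/-- The identification of two nearby fibres given by a local trivialisation. -/
abbrev transition (p : L.base × L.base) : FibreIsometry A :=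
  ⟨p.1, p.2, (L.toFibre p.2).trans (L.toFibre p.1).symm⟩

/-- The values of a family at the transition maps, read in a local trivialisation. -/
def inChart (F : FibreFamily A) (p : L.base × L.base) : A s := L.toFibre p.1 (F (L.transition p))

theorem inChart_diag (F : FibreFamily A) (t : L.base) :
    L.inChart F (t, t) = L.toFibre t (F (.refl A t)) :=
  congrArg (fun T => L.toFibre t (F ⟨t, t, T⟩)) (L.toFibre t).self_trans_symm

theorem norm_inChart (F : FibreFamily A) (p : L.base × L.base) :
    ‖L.inChart F p‖ = ‖F (L.transition p)‖ :=
  (L.toFibre p.1).norm_map _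

theorem lipschitzWith_inChart (p : L.base × L.base) : LipschitzWith 1 fun F => L.inChart F p :=
  (one_mul (1 : NNReal)) ▸
    (L.toFibre p.1).isometry.lipschitz.comp (FibreFamily.lipschitzWith_apply (L.transition p))

end LocalTrivialization

variable (L : ∀ s, U.LocalTrivialization s)

/-- The families that are continuous near the diagonal in the local trivialisations `L` and vanish
at infinity in the second variable. -/
noncomputable def families : Submodule ℂ (FibreFamily A) where
  carrier := {F | Tendsto (fun i => ‖F i‖) (comap FibreIsometry.src (cocompact Ω)) (𝓝 0) ∧
    ∀ s, ContinuousAt ((L s).inChart F) ((L s).center, (L s).center)}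
  add_mem' := fun {F G} hF hG => ⟨squeeze_zero (fun _ => norm_nonneg _)
    (fun i => norm_add_le (F i) (G i)) (by simpa using hF.1.add hG.1),
    fun s => ((hF.2 s).add (hG.2 s)).congr (Eventually.of_forall fun p => (map_add _ _ _).symm)⟩
  zero_mem' := ⟨by simpa using tendsto_const_nhds,
    fun s => continuousAt_const.congr (Eventually.of_forall fun p => (map_zero _).symm)⟩
  smul_mem' := fun c F hF => ⟨(by simpa using hF.1.const_mul ‖c‖ :
      Tendsto (fun i => ‖c‖ * ‖F i‖) _ (𝓝 0)).congr fun i => (norm_smul c (F i)).symm,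
    fun s => ((hF.2 s).const_smul c).congr (Eventually.of_forall fun p => (map_smul _ _ _).symm)⟩

theorem isClosed_families : IsClosed (families L : Set (FibreFamily A)) := by
  have hnorm := LipschitzWith.uniformEquicontinuous
    (fun (i : FibreIsometry A) (F : FibreFamily A) => ‖F i‖) 1 fun i => by
      simpa only [mul_one, Function.comp_def] using
        lipschitzWith_one_norm.comp (FibreFamily.lipschitzWith_apply i)
  have hchart := fun s => LipschitzWith.uniformEquicontinuous
    (fun p F => (L s).inChart F p) 1 (L s).lipschitzWith_inChart
  refine (hnorm.equicontinuous.isClosed_setOfPred_tendsto continuous_const).and ?_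
  rw [ofPred_forall]
  exact isClosed_iInter fun s => (hchart s).equicontinuous.isClosed_setOfPred_tendsto
    ((L s).lipschitzWith_inChart _).continuous

theorem ofTarget_mul_mem_families (a : U.sectionAlgebra) {F : FibreFamily A}
    (hF : F ∈ families L) : FibreFamily.ofTarget a * F ∈ families L := by
  refine ⟨squeeze_zero (fun _ => norm_nonneg _) (fun i => ?_) (by simpa using hF.1.const_mul ‖a‖),
    fun s => ?_⟩
  · exact (norm_mul_le _ _).trans
      (mul_le_mul_of_nonneg_right (U.norm_evalCLM_le i.tgt a) (norm_nonneg _))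
  · exact ((((L s).continuous _ a.2.1).comp continuous_fst).continuousAt.mul (hF.2 s)).congr
      (Eventually.of_forall fun p => ((L s).map_mul p.1 _ _).symm)

theorem ofSource_mem_families (a : U.sectionAlgebra) :
    FibreFamily.ofSource a ∈ families L := by
  refine ⟨(a.2.2.comp tendsto_comap).congr fun i => (i.iso.norm_map _).symm, fun s => ?_⟩
  exact (((L s).continuous _ a.2.1).comp continuous_snd).continuousAt.congr
    (Eventually.of_forall fun p => (((L s).toFibre p.1).apply_symm_apply _).symm)

theorem apply_refl_mem {F : FibreFamily A} (hF : F ∈ families L) :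
    (fun t => F (.refl A t)) ∈ U.Θ := by
  refine mem_of_continuousAt_localTrivialization L fun s => ?_
  have hdiag : ContinuousAt (fun t : (L s).base => (t, t)) (L s).center := by fun_prop
  exact (ContinuousAt.comp (f := fun t : (L s).base => (t, t)) (hF.2 s) hdiag).congr
    (Eventually.of_forall fun t => (L s).inChart_diag F t)

/-- The left Banach module of families, a section acting by multiplication in the target. It plays
the part of the projective tensor square of the section algebra. -/
noncomputable def familyModule [∀ t, IsScalarTower ℂ (A t) (A t)]
    [∀ t, SMulCommClass ℂ (A t) (A t)] : LeftBanachModule U.sectionAlgebra (families L) where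
  act := LinearMap.mkContinuous₂
    (LinearMap.mk₂ ℂ
      (fun a F => (⟨FibreFamily.ofTarget a * F, ofTarget_mul_mem_families L a F.2⟩ : families L))
      (fun a b F => Subtype.ext
        (add_mul (FibreFamily.ofTarget a) (FibreFamily.ofTarget b) (F : FibreFamily A)))
      (fun c a F => Subtype.ext (smul_mul_assoc c (FibreFamily.ofTarget a) (F : FibreFamily A)))
      (fun a F G => Subtype.ext (mul_add (FibreFamily.ofTarget a) (F : FibreFamily A) G))
      (fun c a F => Subtype.ext (mul_smul_comm c (FibreFamily.ofTarget a) (F : FibreFamily A))))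
    1 fun a F => by
      rw [one_mul]
      exact (norm_mul_le (FibreFamily.ofTarget a) (F : FibreFamily A)).trans
        (mul_le_mul_of_nonneg_right (FibreFamily.norm_ofTarget_le a) (norm_nonneg _))
  mul_act a b F := Subtype.ext
    (mul_assoc (FibreFamily.ofTarget a) (FibreFamily.ofTarget b) (F : FibreFamily A))

/-- The restriction of a family to the identities of the fibres. -/
noncomputable def restrictDiag : families L →L[ℂ] U.sectionAlgebra :=
  have hmem (F : families L) := apply_refl_mem L F.2
  have hzero (F : families L) :
      Tendsto (fun t => ‖(F : FibreFamily A) (.refl A t)‖) (cocompact Ω) (𝓝 0) :=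
    F.2.1.comp (tendsto_comap_iff.2 tendsto_id)
  LinearMap.mkContinuous
    { toFun := fun F => ⟨⟨_, U.memℓp_of_tendsto (hmem F) (hzero F)⟩, hmem F, hzero F⟩
      map_add' := fun _ _ => rfl
      map_smul' := fun _ _ => rfl } 1 fun F => by
    rw [one_mul]
    exact U.norm_le_of_forall_evalCLM_le (norm_nonneg _)
      fun s => lp.norm_apply_le_norm ENNReal.top_ne_zero (F : FibreFamily A) (.refl A s)

/-- `FibreFamily.ofSource` as a bounded linear operator. -/
noncomputable def ofSourceCLM : U.sectionAlgebra →L[ℂ] families L :=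
  LinearMap.mkContinuous
    (LinearMap.codRestrict (families L)
      { toFun := FibreFamily.ofSource
        map_add' := fun _ _ => lp.ext (funext fun i => map_add i.iso _ _)
        map_smul' := fun c _ => lp.ext (funext fun i => map_smul i.iso c _) }
      (ofSource_mem_families L)) 1
    fun a => (FibreFamily.norm_ofSource_le a).trans_eq (one_mul _).symm

theorem restrictDiag_ofSourceCLM (a : U.sectionAlgebra) :
    restrictDiag L (ofSourceCLM L a) = a :=
  U.section_ext fun _ => rfl

section Action

variable [∀ t, IsScalarTower ℂ (A t) (A t)] [∀ t, SMulCommClass ℂ (A t) (A t)]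

theorem familyModule_act_apply (a : U.sectionAlgebra) (F : families L) (i : FibreIsometry A) :
    ((familyModule L).act a F : FibreFamily A) i = U.evalCLM i.tgt a * (F : FibreFamily A) i := rfl

theorem restrictDiag_act (a : U.sectionAlgebra) (F : families L) :
    restrictDiag L ((familyModule L).act a F) = a * restrictDiag L F :=
  U.section_ext fun _ => rfl

end Action

end ContinuousField

end FibreFamilies

section Paracompactness

theorem one_le_norm_of_forall_mul_eq {B : Type*} [NonUnitalNormedRing B] [Nontrivial B] {e : B}
    (he : ∀ a, e * a = a) : 1 ≤ ‖e‖ := by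
  obtain ⟨a, ha⟩ := exists_ne (0 : B)
  refine le_of_mul_le_mul_right ?_ (norm_pos_iff.2 ha)
  calc 1 * ‖a‖ = ‖e * a‖ := by rw [one_mul, he]
    _ ≤ ‖e‖ * ‖a‖ := norm_mul_le e a

variable {Ω : Type u} [TopologicalSpace Ω]

theorem exists_compactlySupported_eqOn_one [T2Space Ω] [LocallyCompactSpace Ω] {K : Set Ω}
    (hK : IsCompact K) : ∃ f : C_c(Ω, ℝ), EqOn f 1 K := by
  obtain ⟨f, hf, -, hsupp, -⟩ :=
    exists_continuous_one_zero_of_isCompact hK isClosed_empty (disjoint_empty K)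
  exact ⟨⟨f, hsupp⟩, hf⟩

namespace ContinuousField

variable {A : Ω → Type v} [∀ t, NonUnitalNormedRing (A t)] [∀ t, NormedSpace ℂ (A t)]
  {U : ContinuousField Ω A} {L : ∀ s, U.LocalTrivialization s} {e : ∀ t, A t}

/-- The points `s` and `t` at which the kernel of `ψ` is large: a section equal to `e` at `s` is
sent to a family of norm at least `1 / 2` at some isometry `A t ≃ A s`. -/
def IsLargeAt (ψ : U.sectionAlgebra → families L) (hmem : e ∈ U.Θ) (s t : Ω) : Prop :=
  ∃ f : C_c(Ω, ℝ), f s = 1 ∧ ∃ T : A t ≃ₗᵢ[ℂ] A s,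
    1 / 2 ≤ ‖(ψ (U.cutoff hmem f) : FibreFamily A) ⟨s, t, T⟩‖

theorem eventually_prod_isLargeAt [T2Space Ω] [LocallyCompactSpace Ω] [∀ t, Nontrivial (A t)]
    (he : ∀ t (a : A t), e t * a = a) (hmem : e ∈ U.Θ) {ψ : U.sectionAlgebra → families L}
    (hψ : ∀ a, restrictDiag L (ψ a) = a) (s : Ω) :
    ∀ᶠ p in 𝓝 (s, s), IsLargeAt ψ hmem p.1 p.2 := by
  obtain ⟨K, hK, hsK⟩ := exists_compact_mem_nhds s
  obtain ⟨f, hf⟩ := exists_compactlySupported_eqOn_one hK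
  let F : FibreFamily A := ψ (U.cutoff hmem f)
  have hFs : F (.refl A s) = e s := by
    have hdiag : F (.refl A s) = (f s : ℂ) • e s :=
      congrArg (U.evalCLM s) (hψ (U.cutoff hmem f))
    rw [hdiag, hf (mem_of_mem_nhds hsK), Pi.one_apply, Complex.ofReal_one, one_smul]
  have hcenter : 1 / 2 < ‖(L s).inChart F ((L s).center, (L s).center)‖ := by
    rw [(L s).inChart_diag, LinearIsometryEquiv.norm_map, hFs]
    linarith [one_le_norm_of_forall_mul_eq (he s)]
  have hlarge : ∀ᶠ p in 𝓝 ((L s).center, (L s).center), 1 / 2 < ‖(L s).inChart F p‖ :=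
    ((ψ (U.cutoff hmem f)).2.2 s).norm.eventually_const_lt hcenter
  have hone : ∀ᶠ p in 𝓝 ((L s).center, (L s).center), f p.1 = 1 := by
    have hcont : Continuous fun p : (L s).base × (L s).base => (p.1 : Ω) := by fun_prop
    exact hcont.continuousAt.eventually (mem_of_superset hsK hf)
  have hopen := (L s).isOpen_base.isOpenEmbedding_subtypeVal
  have hmap := (hopen.prodMap hopen).map_nhds_eq ((L s).center, (L s).center)
  refine hmap ▸ eventually_map.2 ?_
  filter_upwards [hlarge, hone] with p hp hfp
  exact ⟨f, hfp, _, hp.le.trans_eq ((L s).norm_inChart F p)⟩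

variable [∀ t, IsScalarTower ℂ (A t) (A t)] [∀ t, SMulCommClass ℂ (A t) (A t)]

theorem apply_cutoff_mul (he : ∀ t (a : A t), e t * a = a) (hmem : e ∈ U.Θ)
    {ψ : U.sectionAlgebra → families L} (hψ : ∀ a b, ψ (a * b) = (familyModule L).act a (ψ b))
    (f g : C_c(Ω, ℝ)) (i : FibreIsometry A) :
    (ψ (U.cutoff hmem (f * g)) : FibreFamily A) i =
      (f i.tgt : ℂ) • (ψ (U.cutoff hmem g) : FibreFamily A) i := by
  rw [← U.cutoff_mul_cutoff he, hψ, familyModule_act_apply, evalCLM_cutoff, smul_mul_assoc, he]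

theorem apply_cutoff_congr (he : ∀ t (a : A t), e t * a = a) (hmem : e ∈ U.Θ)
    {ψ : U.sectionAlgebra → families L} (hψ : ∀ a b, ψ (a * b) = (familyModule L).act a (ψ b))
    {f g : C_c(Ω, ℝ)} {i : FibreIsometry A} (hf : f i.tgt = 1) (hg : g i.tgt = 1) :
    (ψ (U.cutoff hmem f) : FibreFamily A) i = (ψ (U.cutoff hmem g) : FibreFamily A) i := by
  have hfg := apply_cutoff_mul he hmem hψ f g i
  rw [mul_comm, apply_cutoff_mul he hmem hψ g f i, hf, hg] at hfg
  simpa only [Complex.ofReal_one, one_smul] using hfg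

theorem exists_isCompact_of_isLargeAt [T2Space Ω] [LocallyCompactSpace Ω]
    (he : ∀ t (a : A t), e t * a = a) (hmem : e ∈ U.Θ) {ψ : U.sectionAlgebra → families L}
    (hψ : ∀ a b, ψ (a * b) = (familyModule L).act a (ψ b)) {K : Set Ω} (hK : IsCompact K) :
    ∃ M : Set Ω, IsCompact M ∧ ∀ s ∈ K, ∀ t, IsLargeAt ψ hmem s t → t ∈ M := by
  obtain ⟨g, hg⟩ := exists_compactlySupported_eqOn_one hK
  have hsmall := (ψ (U.cutoff hmem g)).2.1.eventually_lt_const (by norm_num : (0 : ℝ) < 1 / 2)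
  obtain ⟨S, hS, hSψ⟩ := mem_comap.1 hsmall
  obtain ⟨M, hM, hMS⟩ := mem_cocompact.1 hS
  refine ⟨M, hM, fun s hs t ⟨f, hf, T, hT⟩ => ?_⟩
  by_contra ht
  rw [apply_cutoff_congr he hmem hψ (i := ⟨s, t, T⟩) hf (hg hs)] at hT
  exact not_lt.2 hT (hSψ (a := ⟨s, t, T⟩) (hMS ht))

theorem IsLocallyTrivial.paracompactSpace_of_isLeftProjective [T2Space Ω] [LocallyCompactSpace Ω]
    [∀ t, CompleteSpace (A t)] [∀ t, Nontrivial (A t)] (hU : U.IsLocallyTrivial)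
    (he : ∀ t (a : A t), e t * a = a) (hmem : e ∈ U.Θ) (hproj : IsLeftProjective U.sectionAlgebra) :
    ParacompactSpace Ω := by
  let L : ∀ s, U.LocalTrivialization s := fun s => (hU.nonempty_localTrivialization s).some
  have : CompleteSpace (families L) := (isClosed_families L).completeSpace_coe
  obtain ⟨ψ, hψ, hright⟩ := hproj (families L) (familyModule L) (restrictDiag L)
    (restrictDiag_act L) ⟨ofSourceCLM L, restrictDiag_ofSourceCLM L⟩
  have hproper : IsProperDiagonalNhd (IsLargeAt ψ hmem) :=
    { eventually_prod := eventually_prod_isLargeAt he hmem hright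
      exists_isCompact := fun K => exists_isCompact_of_isLargeAt he hmem hψ }
  obtain ⟨P⟩ := hproper.nonempty_exhaustedPartition
  exact P.paracompactSpace

end ContinuousField

end Paracompactness

theorem theorem4p13 {Ω : Type u} [TopologicalSpace Ω] [T2Space Ω] [LocallyCompactSpace Ω]
    {A : Ω → Type v} [∀ t, NonUnitalNormedRing (A t)] [∀ t, NormedSpace ℂ (A t)]
    [∀ t, IsScalarTower ℂ (A t) (A t)] [∀ t, SMulCommClass ℂ (A t) (A t)]
    [∀ t, CompleteSpace (A t)] [∀ t, Nontrivial (A t)]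
    (U : ContinuousField Ω A) (hU : U.IsLocallyTrivial)
    (e : ∀ t, A t) (he : ∀ t (a : A t), e t * a = a ∧ a * e t = a)
    (C : ℝ) (hC : ∀ t, ‖e t‖ ≤ C) :
    List.TFAE [
      ParacompactSpace Ω,
      IsLeftProjective U.sectionAlgebra,
      IsLeftProjective U.sectionAlgebra ∧ U.IsDisjointUnionOfSigmaLocallyTrivial,
      H2VanishesOnRightAnnihilators U.sectionAlgebra] := by
  have hl : ∀ t (a : A t), e t * a = a := fun t a => (he t a).1
  have hr : ∀ t (a : A t), a * e t = a := fun t a => (he t a).2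
  have hmem : e ∈ U.Θ := hU.unit_mem he
  tfae_have 1 → 3 := fun _ => ⟨ContinuousField.isLeftProjective_of_paracompactSpace hr hmem hC,
    hU.isDisjointUnionOfSigmaLocallyTrivial⟩
  tfae_have 3 → 2 := And.left
  tfae_have 2 → 1 := hU.paracompactSpace_of_isLeftProjective hl hmem
  tfae_have 2 ↔ 4 := isLeftProjective_iff_h2VanishesOnRightAnnihilators
  tfae_finish
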